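/- Let $R=P/Q$ be a rational function with complex coefficients, $P$ and $Q$ coprime polynomials, of degree $\max(\deg P,\deg Q)\ge 2$, regarded as a map $R:\widehat{\mathbb C}\to\widehat{\mathbb C}$ of the Riemann sphere. The Fatou set of $R$ is the set of points that have a neighbourhood on which the iterates $R^n$ form a normal family, i.e. every sequence of iterates has a subsequence converging uniformly on compact subsets in the spherical metric; a Fatou component is a connected component of the Fatou set. Let $A_0$ be a Fatou component of $R$ which is an annulus, i.e. a domain whose complement in $\widehat{\mathbb C}$ has exactly two connected components, and let $A_{n+1}=R(A_n)$ for $n=0,1,2,\dots$. Assume that for every $n\ge 0$ the map $R:A_n\to A_{n+1}$ is a covering map, and let $d_n$ be its degree (the number of points in each fibre). If the sets $A_n$, $n\ge 0$, are pairwise disjoint, then there is an $N$ such that $d_n=1$ for all $n\ge N$. -/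

import Mathlib

open Filter

noncomputable section

namespace RationalDynamics

/-- The Riemann sphere, i.e. the one-point compactification of the complex plane. -/
abbrev Sphere : Type := OnePoint ℂ

/-- The chordal metric on the Riemann sphere: the Euclidean length of the chord between the
images of the two points on the unit sphere under stereographic projection. -/
def chordal : Sphere → Sphere → ℝ
  | OnePoint.some z, OnePoint.some w =>
      2 * ‖z - w‖ / (Real.sqrt (1 + ‖z‖ ^ 2) * Real.sqrt (1 + ‖w‖ ^ 2))
  | OnePoint.some z, OnePoint.infty => 2 / Real.sqrt (1 + ‖z‖ ^ 2)
  | OnePoint.infty, OnePoint.some w => 2 / Real.sqrt (1 + ‖w‖ ^ 2)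
  | OnePoint.infty, OnePoint.infty => 0

/-- The degree of a rational function `R = P / Q`, with `P` and `Q` coprime polynomials: the
maximum of the degrees of `P` and `Q`. -/
def ratDegree (R : RatFunc ℂ) : ℕ := max R.num.natDegree R.denom.natDegree

open Classical in
/-- The self-map of the Riemann sphere defined by a rational function `R = P / Q`, with `P` and
`Q` coprime (and `Q ≠ 0`). It sends the zeros of `Q` to `∞`; its value at `∞` is the limit of
`P z / Q z` as `z → ∞`. -/
def ratMap (R : RatFunc ℂ) : Sphere → Sphere
  | OnePoint.some z =>
      if R.denom.eval z = 0 then OnePoint.infty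
      else OnePoint.some (R.num.eval z / R.denom.eval z)
  | OnePoint.infty =>
      if R.denom.natDegree < R.num.natDegree then OnePoint.infty
      else OnePoint.some (R.num.coeff R.denom.natDegree / R.denom.leadingCoeff)

/-- The family `F` of self-maps of the sphere is normal on `U`: every sequence of members has a
subsequence that converges uniformly on each compact subset of `U`, in the chordal metric. -/
def IsNormalOn {ι : Type*} (F : ι → Sphere → Sphere) (U : Set Sphere) : Prop :=
  ∀ s : ℕ → ι, ∃ φ : ℕ → ℕ, StrictMono φ ∧ ∃ g : Sphere → Sphere,
    ∀ K : Set Sphere, IsCompact K → K ⊆ U → ∀ ε : ℝ, 0 < ε →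
      ∀ᶠ n in atTop, ∀ z ∈ K, chordal (F (s (φ n)) z) (g z) < ε

/-- The Fatou set of a self-map `f` of the sphere: the points that have an open neighbourhood on
which the iterates of `f` form a normal family. -/
def fatouSet (f : Sphere → Sphere) : Set Sphere :=
  {z | ∃ U : Set Sphere, IsOpen U ∧ z ∈ U ∧ IsNormalOn (fun n : ℕ => f^[n]) U}

/-- `A` is a Fatou component of `f`: a connected component of the Fatou set. -/
def IsFatouComponent (f : Sphere → Sphere) (A : Set Sphere) : Prop :=
  ∃ z ∈ fatouSet f, A = connectedComponentIn (fatouSet f) z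

/-- `A` is an annulus in the sphere, i.e. a doubly connected domain: a nonempty connected open
set whose complement in the sphere has exactly two connected components. -/
def IsAnnulus (A : Set Sphere) : Prop :=
  IsOpen A ∧ IsConnected A ∧ Nat.card (ConnectedComponents ↥(Aᶜ)) = 2

/-- `f` restricts to a covering map `A → B` of degree `k`, i.e. all of whose fibres have exactly
`k` points. -/
def IsCoveringOfDegree (f : Sphere → Sphere) (A B : Set Sphere) (k : ℕ) : Prop :=
  ∃ h : Set.MapsTo f A B, IsCoveringMap (h.restrict f A B) ∧
    ∀ w ∈ B, {z ∈ A | f z = w}.encard = (k : ℕ∞)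

end RationalDynamics

end

/-!
A rational map `R` of degree at least one has no Fatou component that is an annulus, whose images
under the iterates of `R` are pairwise disjoint, and along whose orbit `R` is a covering. The
eventual injectivity asserted by the theorem follows, because its hypotheses cannot hold together.
This is the case of unbranched doubly connected components of the theorem that rational maps have no
wandering domains; it has a proof without quasiconformal deformations, in the manner of Baker.

Let `A n` be the orbit of such an annulus, and read the sphere in the chart `mob a`, which is
`z ↦ 1 / (z - a)` for some `a ∈ A 0`. The sets `A n` with `n ≥ 1` are then uniformly bounded, so
that the iterates on `A 1` are bounded holomorphic functions with disjoint images. By an estimate of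
Landau type (`exists_ball_subset_image_ball`) their derivatives tend to zero, and the iterates
shrink every compact subset `K` of `A 0` to a point (`eventually_oscillation_lt`).

Take `K` connected and such that it separates the two components of the complement of `A 0`
(`IsAnnulus.exists_separating`). Once `R^[n] K` is small for all `n ≥ N`, the maximum principle,
applied along the orbit, shows that the iterates also shrink the bounded components of the
complement of `R^[N] K` (`norm_sub_le_of_frontier`). The preimages of these components under
`R^[N]` therefore belong to the Fatou set. A bounded component that is not contained in `A N` would
contain a boundary point of `A N`, hence the image of a boundary point of `A 0` that lies in the
Fatou set, which is absurd for a component of the Fatou set (`subset_of_frontier_subset`).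

So the complement of `A N` lies in the unbounded component of the complement of `R^[N] K`, and a
fine square grid provides a neighbourhood of `R^[N] K` in `A N` without holes
(`exists_gridRegion`). Such a region behaves like a simply connected space: maps from it lift
through coverings (`exists_lift_gridRegion`). In place of homotopies, the proof uses that the
obstruction, a defect of flatness of a labelling of the edges of the grid by permutations of the
fibre, can be pushed out of the region square by square (`exists_potential`).

Lifting the inclusion of this region into `A N` back through the coverings `A n → A (n + 1)` yields
a map `s` to `A 0` with `s (R^[N] x) = x` on `K` (`exists_lift_iterate`). In a chart that sends a
point of one component of the complement of `A 0` to `∞`, and for a point `p` of the other one,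
`s - p` has no zeros and thus has a logarithm on the region; composed with `R^[N]` it becomes a
logarithm of `z - p` on `K`. This is impossible, since `K` separates `p` from `∞`
(`false_of_exp_eq_sub`).
-/

namespace RationalDynamics

open Topology Set

noncomputable section

/-! ### The Riemann sphere -/

/-- The affine coordinate of a point of the sphere, with the junk value `0` at `∞`. -/
def toC (z : Sphere) : ℂ := z.elim 0 id

@[simp] lemma toC_coe (z : ℂ) : toC (z : Sphere) = z := rfl

lemma coe_toC {z : Sphere} (hz : z ≠ OnePoint.infty) : ((toC z : ℂ) : Sphere) = z := by
  obtain ⟨w, rfl⟩ := OnePoint.ne_infty_iff_exists.1 hz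
  rfl

lemma continuousAt_toC {z : Sphere} (hz : z ≠ OnePoint.infty) : ContinuousAt toC z := by
  obtain ⟨w, rfl⟩ := OnePoint.ne_infty_iff_exists.1 hz
  rw [OnePoint.continuousAt_coe]
  exact continuousAt_id

open Classical in
/-- The inversion `z ↦ 1 / z` of the sphere. -/
def inversionFun : Sphere → Sphere
  | OnePoint.some z => if z = 0 then OnePoint.infty else OnePoint.some z⁻¹
  | OnePoint.infty => OnePoint.some 0

lemma inversionFun_coe {z : ℂ} (hz : z ≠ 0) : inversionFun z = (z⁻¹ : ℂ) := by
  change (if z = 0 then _ else _) = _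
  rw [if_neg hz]

@[simp] lemma inversionFun_zero : inversionFun ((0 : ℂ) : Sphere) = OnePoint.infty := by
  change (if (0 : ℂ) = 0 then _ else _) = _
  rw [if_pos rfl]

@[simp] lemma inversionFun_infty : inversionFun OnePoint.infty = ((0 : ℂ) : Sphere) := rfl

lemma inversionFun_involutive : Function.Involutive inversionFun := by
  intro z
  induction z using OnePoint.rec with
  | infty => simp
  | coe z =>
    by_cases hz : z = 0
    · simp [hz]
    · rw [inversionFun_coe hz, inversionFun_coe (inv_ne_zero hz), inv_inv]

lemma coclosedCompact_eq_cobounded : coclosedCompact ℂ = Bornology.cobounded ℂ := by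
  rw [coclosedCompact_eq_cocompact, Metric.cobounded_eq_cocompact]

lemma continuous_inversionFun : Continuous inversionFun := by
  rw [OnePoint.continuous_iff]
  constructor
  · rw [coclosedCompact_eq_cobounded]
    refine ((OnePoint.continuous_coe.tendsto (0 : ℂ)).comp
      tendsto_inv₀_cobounded).congr' ?_
    filter_upwards [Bornology.eventually_ne_cobounded (0 : ℂ)] with z hz
    exact (inversionFun_coe hz).symm
  · rw [continuous_iff_continuousAt]
    intro z
    by_cases hz : z = 0
    · subst hz
      rw [continuousAt_iff_punctured_nhds, inversionFun_zero]
      have h := OnePoint.tendsto_coe_infty (X := ℂ)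
      rw [coclosedCompact_eq_cobounded] at h
      refine (h.comp tendsto_inv₀_nhdsNE_zero).congr' ?_
      filter_upwards [self_mem_nhdsWithin] with w hw
      exact (inversionFun_coe hw).symm
    · have : ContinuousAt (fun w : ℂ => ((w⁻¹ : ℂ) : Sphere)) z :=
        OnePoint.continuous_coe.continuousAt.comp (continuousAt_inv₀ hz)
      refine this.congr ?_
      filter_upwards [eventually_ne_nhds hz] with w hw
      exact (inversionFun_coe hw).symm

/-- The Möbius transformation `z ↦ 1 / (z - a)` as a homeomorphism of the sphere. It is the chart
of the sphere that sends `a` to `∞`. -/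
def mob (a : ℂ) : Sphere ≃ₜ Sphere :=
  (Homeomorph.onePointCongr (Homeomorph.addRight (-a))).trans
    { toFun := inversionFun
      invFun := inversionFun
      left_inv := inversionFun_involutive
      right_inv := inversionFun_involutive
      continuous_toFun := continuous_inversionFun
      continuous_invFun := continuous_inversionFun }

lemma mob_coe {a z : ℂ} (h : z ≠ a) : mob a z = (((z - a)⁻¹ : ℂ) : Sphere) := by
  change inversionFun ((z + -a : ℂ) : Sphere) = _
  rw [← sub_eq_add_neg, inversionFun_coe (sub_ne_zero.2 h)]

@[simp] lemma mob_self (a : ℂ) : mob a a = OnePoint.infty := by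
  change inversionFun ((a + -a : ℂ) : Sphere) = _
  rw [add_neg_cancel, inversionFun_zero]

lemma mob_eq_infty {a : ℂ} {z : Sphere} : mob a z = OnePoint.infty ↔ z = a := by
  rw [← mob_self a, (mob a).injective.eq_iff]

lemma mob_symm_coe {a w : ℂ} (hw : w ≠ 0) : (mob a).symm w = ((a + w⁻¹ : ℂ) : Sphere) := by
  rw [Homeomorph.symm_apply_eq, mob_coe (by simpa using hw)]
  simp

lemma norm_toC_mob_le {a : ℂ} {r : ℝ} (hr : 0 < r) {z : Sphere}
    (hz : z ∉ ((↑) : ℂ → Sphere) '' Metric.ball a r) : ‖toC (mob a z)‖ ≤ r⁻¹ := by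
  induction z using OnePoint.rec with
  | infty =>
    have : mob a OnePoint.infty = ((0 : ℂ) : Sphere) := rfl
    rw [this]; simpa using hr.le
  | coe z =>
    have h : r ≤ ‖z - a‖ := by
      by_contra! h
      exact hz ⟨z, by simpa [dist_eq_norm] using h, rfl⟩
    have hza : z ≠ a := by rintro rfl; simp at h; linarith
    rw [mob_coe hza, toC_coe, norm_inv]
    exact inv_anti₀ hr h

/-! ### Rational maps -/

lemma ratMap_coe {R : RatFunc ℂ} {z : ℂ} (hz : R.denom.eval z ≠ 0) :
    ratMap R z = ((R.num.eval z / R.denom.eval z : ℂ) : Sphere) := by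
  change (if R.denom.eval z = 0 then _ else _) = _
  rw [if_neg hz]

lemma ratMap_pole {R : RatFunc ℂ} {z : ℂ} (hz : R.denom.eval z = 0) :
    ratMap R z = OnePoint.infty := by
  change (if R.denom.eval z = 0 then _ else _) = _
  rw [if_pos hz]

lemma eval_eq_reverse_eval_inv_mul_pow (P : Polynomial ℂ) {z : ℂ} (hz : z ≠ 0) :
    P.eval z = P.reverse.eval z⁻¹ * z ^ P.natDegree := by
  let _ := invertibleOfNonzero hz
  have := Polynomial.eval₂_reverse_mul_pow (RingHom.id ℂ) z P
  rw [invOf_eq_inv] at this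
  simpa [Polynomial.eval₂_eq_eval_map] using this.symm

lemma tendsto_reverse_eval_inv (P : Polynomial ℂ) :
    Tendsto (fun z : ℂ => P.reverse.eval z⁻¹) (Bornology.cobounded ℂ) (𝓝 P.leadingCoeff) := by
  have h := (P.reverse.continuous.tendsto (0 : ℂ)).comp tendsto_inv₀_cobounded
  rwa [← Polynomial.coeff_zero_eq_eval_zero, Polynomial.coeff_zero_reverse] at h

lemma tendsto_coe_infty_of_norm {α : Type*} {l : Filter α} {f : α → ℂ}
    (h : Tendsto (fun x => ‖f x‖) l atTop) :
    Tendsto (fun x => (f x : Sphere)) l (𝓝 OnePoint.infty) := by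
  have h1 := OnePoint.tendsto_coe_infty (X := ℂ)
  rw [coclosedCompact_eq_cobounded] at h1
  exact h1.comp (tendsto_norm_atTop_iff_cobounded.1 h)

lemma continuous_ratMap (R : RatFunc ℂ) : Continuous (ratMap R) := by
  have hQ0 : R.denom.leadingCoeff ≠ 0 := Polynomial.leadingCoeff_ne_zero.2 R.denom_ne_zero
  rw [OnePoint.continuous_iff]
  constructor
  · rw [coclosedCompact_eq_cobounded]
    have hQ : ∀ᶠ z : ℂ in Bornology.cobounded ℂ, R.denom.eval z ≠ 0 := by
      have : (R.denom.roots.toFinset : Set ℂ)ᶜ ∈ Bornology.cobounded ℂ :=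
        Bornology.le_cofinite ℂ R.denom.roots.toFinset.finite_toSet.compl_mem_cofinite
      filter_upwards [this] with z hz h0
      exact hz (by simpa [R.denom_ne_zero] using h0)
    have hlim := (tendsto_reverse_eval_inv R.num).div (tendsto_reverse_eval_inv R.denom) hQ0
    have hform : ∀ᶠ z : ℂ in Bornology.cobounded ℂ, R.num.eval z / R.denom.eval z =
        R.num.reverse.eval z⁻¹ / R.denom.reverse.eval z⁻¹ *
          (z ^ R.num.natDegree / z ^ R.denom.natDegree) := by
      filter_upwards [Bornology.eventually_ne_cobounded (0 : ℂ)] with z hz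
      rw [eval_eq_reverse_eval_inv_mul_pow R.num hz, eval_eq_reverse_eval_inv_mul_pow R.denom hz,
        mul_div_mul_comm]
    have key : Tendsto (fun z : ℂ => ((R.num.eval z / R.denom.eval z : ℂ) : Sphere))
        (Bornology.cobounded ℂ) (𝓝 (ratMap R OnePoint.infty)) := by
      by_cases hdeg : R.denom.natDegree < R.num.natDegree
      · have h1 : ratMap R OnePoint.infty = OnePoint.infty := by
          change (if _ then _ else _) = _
          rw [if_pos hdeg]
        rw [h1]
        apply tendsto_coe_infty_of_norm
        have hP0 : R.num.leadingCoeff ≠ 0 := by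
          rw [Polynomial.leadingCoeff_ne_zero]
          rintro h; simp [h] at hdeg
        have h2 : Tendsto (fun z : ℂ => ‖z‖ ^ (R.num.natDegree - R.denom.natDegree))
            (Bornology.cobounded ℂ) atTop :=
          (tendsto_pow_atTop (by omega)).comp tendsto_norm_cobounded_atTop
        refine (Tendsto.pos_mul_atTop (norm_pos_iff.2 (div_ne_zero hP0 hQ0)) hlim.norm h2).congr' ?_
        filter_upwards [hform, Bornology.eventually_ne_cobounded (0 : ℂ)] with z hz hz0
        rw [hz, norm_mul, ← norm_pow, pow_sub₀ _ hz0 hdeg.le, div_eq_mul_inv (z ^ _)]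
        rfl
      · have h1 : ratMap R OnePoint.infty =
            ((R.num.coeff R.denom.natDegree / R.denom.leadingCoeff : ℂ) : Sphere) := by
          change (if _ then _ else _) = _
          rw [if_neg hdeg]
        rw [h1]
        refine (OnePoint.continuous_coe.tendsto _).comp ?_
        refine Tendsto.congr' (EventuallyEq.symm hform) ?_
        rcases (not_lt.1 hdeg).eq_or_lt with he | hlt
        · have : R.num.coeff R.denom.natDegree / R.denom.leadingCoeff =
              R.num.leadingCoeff / R.denom.leadingCoeff * 1 := by
            rw [mul_one, ← he]; rfl
          rw [this]
          refine hlim.mul (tendsto_const_nhds.congr' ?_)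
          filter_upwards [Bornology.eventually_ne_cobounded (0 : ℂ)] with z hz
          rw [he, div_self (pow_ne_zero _ hz)]
        · have : R.num.coeff R.denom.natDegree / R.denom.leadingCoeff =
              R.num.leadingCoeff / R.denom.leadingCoeff * 0 := by
            rw [Polynomial.coeff_eq_zero_of_natDegree_lt hlt]; simp
          rw [this]
          refine hlim.mul ?_
          have h2 := (tendsto_inv₀_cobounded (α := ℂ)).pow
            (R.denom.natDegree - R.num.natDegree)
          rw [zero_pow (by omega)] at h2
          refine h2.congr' ?_
          filter_upwards [Bornology.eventually_ne_cobounded (0 : ℂ)] with z hz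
          rw [inv_pow, pow_sub₀ _ hz hlt.le, mul_inv, inv_inv, mul_comm, div_eq_mul_inv]
    refine key.congr' ?_
    filter_upwards [hQ] with z hz
    exact (ratMap_coe hz).symm
  · rw [continuous_iff_continuousAt]
    intro z
    have hc : ∀ P : Polynomial ℂ, ContinuousAt (fun z => P.eval z) z :=
      fun P => P.continuous.continuousAt
    by_cases hz : R.denom.eval z = 0
    · have hnum : R.num.eval z ≠ 0 := by
        intro h
        obtain ⟨u, v, huv⟩ := R.isCoprime_num_denom
        have := congrArg (Polynomial.eval z) huv
        simp [h, hz] at this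
      have hev : ∀ᶠ w in 𝓝[≠] z, R.denom.eval w ≠ 0 := by
        have h1 : ((R.denom.roots.toFinset : Set ℂ) \ {z})ᶜ ∈ 𝓝 z :=
          (R.denom.roots.toFinset.finite_toSet.sdiff.isClosed).isOpen_compl.mem_nhds (by simp)
        filter_upwards [mem_nhdsWithin_of_mem_nhds h1, self_mem_nhdsWithin] with w hw hwz h0
        exact hw ⟨by simpa [R.denom_ne_zero] using h0, hwz⟩
      rw [continuousAt_iff_punctured_nhds, ratMap_pole hz]
      have : Tendsto (fun w => ((R.num.eval w / R.denom.eval w : ℂ) : Sphere)) (𝓝[≠] z)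
          (𝓝 OnePoint.infty) := by
        apply tendsto_coe_infty_of_norm
        have h1 : Tendsto (fun w => (R.denom.eval w)⁻¹) (𝓝[≠] z) (Bornology.cobounded ℂ) := by
          refine tendsto_inv₀_nhdsNE_zero.comp
            (tendsto_nhdsWithin_of_tendsto_nhds_of_eventually_within _ ?_ hev)
          rw [← hz]
          exact (hc R.denom).tendsto.mono_left nhdsWithin_le_nhds
        refine (Tendsto.pos_mul_atTop (norm_pos_iff.2 hnum)
          ((hc R.num).tendsto.norm.mono_left nhdsWithin_le_nhds)
          (tendsto_norm_cobounded_atTop.comp h1)).congr fun w => ?_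
        simp [div_eq_mul_inv]
      refine this.congr' ?_
      filter_upwards [hev] with w hw
      exact (ratMap_coe hw).symm
    · have : ContinuousAt (fun w => ((R.num.eval w / R.denom.eval w : ℂ) : Sphere)) z :=
        OnePoint.continuous_coe.continuousAt.comp ((hc _).div (hc _) hz)
      refine this.congr ?_
      filter_upwards [(hc R.denom).eventually_ne hz] with w hw
      exact (ratMap_coe hw).symm

end

/-- A nonconstant rational function takes each value at finitely many points only. -/
lemma finite_setOf_ratMap_eq {R : RatFunc ℂ} (hR : 1 ≤ ratDegree R) (v : Sphere) :
    {z : ℂ | ratMap R z = v}.Finite := by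
  induction v using OnePoint.rec with
  | infty =>
    refine R.denom.roots.toFinset.finite_toSet.subset fun z hz => ?_
    by_contra h
    have h0 : R.denom.eval z ≠ 0 := by simpa [R.denom_ne_zero] using h
    rw [mem_ofPred_eq, ratMap_coe h0] at hz
    exact OnePoint.coe_ne_infty _ hz
  | coe v =>
    have hne : R.num - Polynomial.C v * R.denom ≠ 0 := by
      intro h
      rw [sub_eq_zero] at h
      have hu : IsUnit R.denom := by
        refine R.isCoprime_num_denom.symm.isUnit_of_dvd ?_
        rw [h]; exact dvd_mul_left _ _
      have h1 := Polynomial.natDegree_eq_zero_of_isUnit hu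
      have h2 : R.num.natDegree ≤ 0 := by
        rw [h, ← h1]; exact Polynomial.natDegree_C_mul_le _ _
      simp only [ratDegree] at hR
      omega
    refine (R.num - Polynomial.C v * R.denom).roots.toFinset.finite_toSet.subset fun z hz => ?_
    have h0 : R.denom.eval z ≠ 0 := by
      intro h0
      rw [mem_ofPred_eq, ratMap_pole h0] at hz
      exact OnePoint.infty_ne_coe _ hz
    rw [mem_ofPred_eq, ratMap_coe h0, OnePoint.coe_eq_coe, div_eq_iff h0] at hz
    simp [hne, hz]

lemma meromorphicAt_eval (P : Polynomial ℂ) {g : ℂ → ℂ} {w : ℂ} (hg : MeromorphicAt g w) :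
    MeromorphicAt (fun z => P.eval (g z)) w := by
  simp only [Polynomial.eval_eq_sum_range]
  fun_prop

/-- A rational map read in two charts of the sphere is holomorphic wherever it is finite: it is
continuous there, and it agrees with a rational expression off a finite set. -/
lemma analyticAt_ratMap_chart (R : RatFunc ℂ) (b c w : ℂ)
    (hw : mob c (ratMap R ((mob b).symm w)) ≠ OnePoint.infty) :
    AnalyticAt ℂ (fun w : ℂ => toC (mob c (ratMap R ((mob b).symm w)))) w := by
  refine MeromorphicAt.analyticAt (MeromorphicAt.congr
    (f := fun w => (R.num.eval (b + w⁻¹) / R.denom.eval (b + w⁻¹) - c)⁻¹) ?_ ?_) ?_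
  · have hg : MeromorphicAt (fun w : ℂ => b + w⁻¹) w := by fun_prop
    exact (((meromorphicAt_eval _ hg).div (meromorphicAt_eval _ hg)).sub
      (MeromorphicAt.const c w)).inv
  · have hfin : (insert 0 ((fun r => (r - b)⁻¹) '' (R.denom.roots.toFinset : Set ℂ))).Finite :=
      (R.denom.roots.toFinset.finite_toSet.image _).insert 0
    have h1 := (hfin.sdiff (t := {w})).isClosed.isOpen_compl.mem_nhds
      (show w ∈ (insert 0 ((fun r => (r - b)⁻¹) '' (R.denom.roots.toFinset : Set ℂ)) \ {w})ᶜ by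
        simp)
    filter_upwards [mem_nhdsWithin_of_mem_nhds h1, self_mem_nhdsWithin] with v hv hvw
    have hv0 : v ≠ 0 := fun h => hv ⟨Or.inl h, hvw⟩
    have hvQ : R.denom.eval (b + v⁻¹) ≠ 0 := by
      intro h
      refine hv ⟨Or.inr ⟨b + v⁻¹, by simpa [R.denom_ne_zero] using h, by simp⟩, hvw⟩
    rw [mob_symm_coe hv0, ratMap_coe hvQ]
    by_cases hc : R.num.eval (b + v⁻¹) / R.denom.eval (b + v⁻¹) = c
    · rw [hc, mob_self, sub_self, inv_zero]; rfl
    · rw [mob_coe hc, toC_coe]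
  · exact ContinuousAt.comp (g := toC) (continuousAt_toC hw) (((mob c).continuous.comp
      ((continuous_ratMap R).comp ((mob b).symm.continuous.comp
        OnePoint.continuous_coe))).continuousAt)

lemma exists_coe_ne (z : Sphere) : ∃ b : ℂ, z ≠ b := by
  induction z using OnePoint.rec with
  | infty => exact ⟨0, OnePoint.infty_ne_coe _⟩
  | coe z => exact ⟨z + 1, by simp⟩

lemma isOpenMap_ratMap {R : RatFunc ℂ} (hR : 1 ≤ ratDegree R) : IsOpenMap (ratMap R) := by
  rw [isOpenMap_iff_nhds_le]
  intro z
  obtain ⟨b, hb⟩ := exists_coe_ne z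
  obtain ⟨c, hc⟩ := exists_coe_ne (ratMap R z)
  obtain ⟨w, hw⟩ := OnePoint.ne_infty_iff_exists.1 (mt mob_eq_infty.1 hb)
  have hzw : (mob b).symm w = z := by rw [hw, Homeomorph.symm_apply_apply]
  set T : ℂ → ℂ := fun w : ℂ => toC (mob c (ratMap R ((mob b).symm w))) with hT
  have hfin : mob c (ratMap R ((mob b).symm w)) ≠ OnePoint.infty := by
    rw [hzw]; exact mt mob_eq_infty.1 hc
  have hcont : Continuous fun w : ℂ => mob c (ratMap R ((mob b).symm w)) :=
    (mob c).continuous.comp ((continuous_ratMap R).comp ((mob b).symm.continuous.comp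
        OnePoint.continuous_coe))
  have hev : ∀ᶠ v : ℂ in 𝓝 w, mob c (ratMap R ((mob b).symm v)) ≠ OnePoint.infty :=
    hcont.continuousAt.eventually_ne hfin
  have hrec : ∀ᶠ v : ℂ in 𝓝 w, (mob c).symm (T v : Sphere) = ratMap R ((mob b).symm v) := by
    filter_upwards [hev] with v hv
    rw [hT, coe_toC hv, Homeomorph.symm_apply_apply]
  have hle : 𝓝 (T w) ≤ map T (𝓝 w) := by
    refine (analyticAt_ratMap_chart R b c w hfin).eventually_constant_or_nhds_le_map_nhds.resolve_left
      fun hconst => ?_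
    have hfib := (finite_setOf_ratMap_eq hR (ratMap R z)).preimage
      (f := fun w : ℂ => b + w⁻¹) (by
        intro x _ y _ hxy
        simpa using hxy)
    refine (infinite_of_mem_nhds w ?_) (hfib.insert 0)
    filter_upwards [hrec, hconst] with v hv hTv
    by_cases hv0 : v = 0
    · exact Or.inl hv0
    · right
      change ratMap R ((b + v⁻¹ : ℂ) : Sphere) = _
      rw [← mob_symm_coe hv0, ← hv, show T v = T w from hTv, hrec.self_of_nhds, hzw]
  have e1 : 𝓝 (ratMap R z) = map (fun v : ℂ => (mob c).symm (v : Sphere)) (𝓝 (T w)) := by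
    rw [← hzw, ← hrec.self_of_nhds, ← (mob c).symm.map_nhds_eq, OnePoint.nhds_coe_eq, map_map]
    rfl
  have e2 : 𝓝 z = map (fun v : ℂ => (mob b).symm (v : Sphere)) (𝓝 w) := by
    rw [← hzw, ← (mob b).symm.map_nhds_eq, OnePoint.nhds_coe_eq, map_map]
    rfl
  rw [e1, e2, map_map]
  refine (map_mono hle).trans ?_
  rw [map_map]
  exact (map_congr hrec).le

/-! ### The chordal metric -/

lemma tendsto_chordal (p : Sphere) : Tendsto (fun z => chordal z p) (𝓝 p) (𝓝 0) := by
  induction p using OnePoint.rec with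
  | infty =>
    rw [OnePoint.tendsto_nhds_infty', coclosedCompact_eq_cobounded]
    refine ⟨tendsto_pure_nhds _ _, ?_⟩
    change Tendsto (fun z : ℂ => 2 / Real.sqrt (1 + ‖z‖ ^ 2)) _ _
    refine Tendsto.div_atTop tendsto_const_nhds ?_
    refine tendsto_atTop_mono (fun z => ?_) (tendsto_norm_cobounded_atTop (E := ℂ))
    exact Real.le_sqrt_of_sq_le (by linarith)
  | coe p =>
    rw [OnePoint.nhds_coe_eq, tendsto_map'_iff]
    change Tendsto (fun z : ℂ => 2 * ‖z - p‖ / (Real.sqrt (1 + ‖z‖ ^ 2) *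
      Real.sqrt (1 + ‖p‖ ^ 2))) _ _
    have : Continuous fun z : ℂ => 2 * ‖z - p‖ / (Real.sqrt (1 + ‖z‖ ^ 2) *
      Real.sqrt (1 + ‖p‖ ^ 2)) := by
      refine Continuous.div (by fun_prop) (by fun_prop) fun z => ?_
      positivity
    simpa using this.tendsto p

/-! ### Bounded holomorphic functions with disjoint images -/

/-- A quantitative open mapping theorem in the style of Landau and Bloch: the image of a disc under
a bounded holomorphic function contains a disc around the image of the centre, whose radius depends
only on the bound and on a lower bound for the derivative at the centre. -/
lemma exists_ball_subset_image_ball {M ρ δ : ℝ} (hM : 0 < M) (hρ : 0 < ρ) (hδ : 0 < δ) :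
    ∃ c > 0, ∀ (F : ℂ → ℂ) (z : ℂ), DifferentiableOn ℂ F (Metric.ball z ρ) →
      (∀ w ∈ Metric.ball z ρ, ‖F w‖ ≤ M) → δ ≤ ‖deriv F z‖ →
      Metric.ball (F z) c ⊆ F '' Metric.ball z ρ := by
  set t : ℝ := min (ρ / 2) (δ * ρ ^ 2 / (8 * M)) with ht
  have ht0 : 0 < t := by positivity
  have htρ : t < ρ := (min_le_left _ _).trans_lt (by linarith)
  refine ⟨t * (δ / 2) / 2, by positivity, fun F z hF hb hd => ?_⟩
  have hz : z ∈ Metric.ball z ρ := Metric.mem_ball_self hρ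
  have hnhds : Metric.ball z ρ ∈ 𝓝 z := Metric.ball_mem_nhds z hρ
  have hg := (Complex.differentiableOn_dslope hnhds).2 hF
  have hgb : ∀ w ∈ Metric.ball z ρ, ‖dslope F z w‖ ≤ 2 * M / ρ := fun w hw =>
    Complex.norm_dslope_le_div_of_mapsTo_ball hF (fun v hv => by
      rw [Metric.mem_closedBall, dist_eq_norm]
      linarith [norm_sub_le (F v) (F z), hb v hv, hb z hz]) hw
  have hgd : ∀ w ∈ Metric.ball z ρ,
      dist (dslope F z w) (dslope F z z) ≤ 4 * M / ρ / ρ * dist w z := fun w hw =>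
    Complex.dist_le_div_mul_dist_of_mapsTo_ball hg (fun v hv => by
      rw [Metric.mem_closedBall, dist_eq_norm]
      have : 4 * M / ρ = 2 * M / ρ + 2 * M / ρ := by ring
      linarith [norm_sub_le (dslope F z v) (dslope F z z), hgb v hv, hgb z hz]) hw
  have hlow : ∀ w ∈ Metric.ball z ρ, dist w z ≤ t → δ / 2 ≤ ‖dslope F z w‖ := by
    intro w hw hwt
    have h1 : 4 * M / ρ / ρ * dist w z ≤ δ / 2 := by
      calc 4 * M / ρ / ρ * dist w z ≤ 4 * M / ρ / ρ * (δ * ρ ^ 2 / (8 * M)) := by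
            gcongr; exact hwt.trans (min_le_right _ _)
        _ = δ / 2 := by field_simp; norm_num
    have h2 := hgd w hw
    rw [dslope_same, dist_eq_norm, norm_sub_rev] at h2
    linarith [norm_sub_norm_le (deriv F z) (dslope F z w)]
  have hsub : Metric.closedBall z t ⊆ Metric.ball z ρ := Metric.closedBall_subset_ball htρ
  have hval : ∀ w, F w - F z = (w - z) * dslope F z w := fun w => by
    rw [← smul_eq_mul, sub_smul_dslope]
  refine (DiffContOnCl.ball_subset_image_closedBall (f := F) (z₀ := z) (r := t)
    (ε := t * (δ / 2)) ?_ ht0 (fun w hw => ?_) ?_).trans (image_mono hsub)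
  · exact (hF.mono (Metric.closure_ball_subset_closedBall.trans hsub)).diffContOnCl
  · rw [hval, norm_mul, ← dist_eq_norm, Metric.mem_sphere.1 hw]
    gcongr
    exact hlow w (hsub (Metric.sphere_subset_closedBall hw)) (Metric.mem_sphere.1 hw).le
  · refine Eventually.frequently (f := 𝓝[≠] z) ?_ |>.filter_mono nhdsWithin_le_nhds
    filter_upwards [mem_nhdsWithin_of_mem_nhds (Metric.closedBall_mem_nhds z ht0),
      self_mem_nhdsWithin] with w hw hwz h
    have h1 := hval w
    rw [h, sub_self, eq_comm, mul_eq_zero, sub_eq_zero] at h1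
    replace h1 := h1.resolve_left hwz
    have h2 := hlow w (hsub hw) hw
    rw [h1, norm_zero] at h2
    linarith

section DisjointImages

variable {U : Set ℂ} {F : ℕ → ℂ → ℂ} {M : ℝ}

/-- Holomorphic functions with a common bound and pairwise disjoint images have derivatives that
tend to zero: otherwise infinitely many of the images would contain discs of a fixed radius with
centres in a fixed disc. -/
lemma eventually_norm_deriv_lt (hM : 0 < M) (hF : ∀ n, DifferentiableOn ℂ (F n) U)
    (hb : ∀ n, ∀ z ∈ U, ‖F n z‖ ≤ M) (hd : ∀ m n, m ≠ n → Disjoint (F m '' U) (F n '' U))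
    {z₀ : ℂ} {r : ℝ} (hr : 0 < r) (hU : Metric.ball z₀ (2 * r) ⊆ U) {δ : ℝ} (hδ : 0 < δ) :
    ∀ᶠ n in atTop, ∀ z ∈ Metric.ball z₀ r, ‖deriv (F n) z‖ < δ := by
  obtain ⟨c, hc, hball⟩ := exists_ball_subset_image_ball hM hr hδ
  by_contra hcon
  have hfreq : ∃ᶠ n in atTop, ∃ z ∈ Metric.ball z₀ r, δ ≤ ‖deriv (F n) z‖ := by
    simpa [Filter.Frequently] using hcon
  obtain ⟨φ, hφ, hz⟩ := extraction_of_frequently_atTop hfreq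
  choose z hz hzd using hz
  have hsub : ∀ k, Metric.ball (z k) r ⊆ U := fun k =>
    (Metric.ball_subset_ball' (by linarith [Metric.mem_ball.1 (hz k)])).trans hU
  have hzU : ∀ k, z k ∈ U := fun k => hsub k (Metric.mem_ball_self hr)
  obtain ⟨p, -, ψ, hψ, hlim⟩ := (isCompact_closedBall (0 : ℂ) M).tendsto_subseq
    (x := fun k => F (φ k) (z k)) fun k => by simpa using hb (φ k) (z k) (hzU k)
  obtain ⟨N, hN⟩ := Metric.cauchySeq_iff.1 hlim.cauchySeq c hc
  have h1 := hN (N + 1) (by omega) N le_rfl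
  have h2 := hball (F (φ (ψ N))) (z (ψ N)) ((hF _).mono (hsub _))
    (fun w hw => hb _ w (hsub _ hw)) (hzd _) h1
  have hne : φ (ψ N) ≠ φ (ψ (N + 1)) := (hφ.comp hψ (Nat.lt_succ_self N)).ne
  exact (disjoint_left.1 (hd _ _ hne)) (image_mono (hsub _) h2) (mem_image_of_mem _ (hzU _))

/-- Holomorphic functions with a common bound and pairwise disjoint images become constant in the
limit: their oscillation on a compact subset of a domain tends to zero. -/
lemma eventually_norm_sub_lt (hM : 0 < M) (hUo : IsOpen U) (hUc : IsPreconnected U)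
    (hF : ∀ n, DifferentiableOn ℂ (F n) U) (hb : ∀ n, ∀ z ∈ U, ‖F n z‖ ≤ M)
    (hd : ∀ m n, m ≠ n → Disjoint (F m '' U) (F n '' U))
    {K : Set ℂ} (hK : IsCompact K) (hKU : K ⊆ U) {ε : ℝ} (hε : 0 < ε) :
    ∀ᶠ n in atTop, ∀ x ∈ K, ∀ y ∈ K, ‖F n x - F n y‖ < ε := by
  have hloc : ∀ x ∈ U, ∃ V ∈ 𝓝 x, ∀ ε > 0, ∀ᶠ n in atTop, ∀ y ∈ V, ‖F n y - F n x‖ < ε := by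
    intro x hx
    obtain ⟨s, hs, hsU⟩ := Metric.isOpen_iff.1 hUo x hx
    have hs2 : Metric.ball x (2 * (s / 2)) ⊆ U := by rwa [mul_div_cancel₀ _ two_ne_zero]
    refine ⟨Metric.ball x (s / 2), Metric.ball_mem_nhds _ (by linarith), fun ε hε => ?_⟩
    filter_upwards [eventually_norm_deriv_lt hM hF hb hd (half_pos hs) hs2
      (show 0 < ε / s by positivity)] with n hn y hy
    have hsub : Metric.ball x (s / 2) ⊆ U := (Metric.ball_subset_ball (by linarith)).trans hsU
    have h1 := Convex.norm_image_sub_le_of_norm_deriv_le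
      (fun w hw => (hF n).differentiableAt (hUo.mem_nhds (hsub hw))) (fun w hw => (hn w hw).le)
      (convex_ball x (s / 2)) (Metric.mem_ball_self (by linarith)) hy
    rw [← dist_eq_norm y] at h1
    calc ‖F n y - F n x‖ ≤ ε / s * dist y x := h1
      _ ≤ ε / s * (s / 2) := by gcongr; exact (Metric.mem_ball.1 hy).le
      _ < ε := by field_simp; linarith
  let P : ℂ → ℂ → Prop := fun x y => ∀ ε > 0, ∀ᶠ n in atTop, ‖F n y - F n x‖ < ε
  have hP : ∀ x ∈ U, ∀ y ∈ U, P x y := by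
    intro x hx y hy
    refine hUc.induction₂ P (fun x hx => ?_) ?_ ?_ hx hy
    · obtain ⟨V, hV, h⟩ := hloc x hx
      filter_upwards [mem_nhdsWithin_of_mem_nhds hV] with y hy ε hε
      filter_upwards [h ε hε] with n hn using hn y hy
    · intro x y z _ _ _ hxy hyz ε hε
      filter_upwards [hxy (ε / 2) (half_pos hε), hyz (ε / 2) (half_pos hε)] with n h1 h2
      linarith [norm_sub_le_norm_sub_add_norm_sub (F n z) (F n y) (F n x)]
    · intro x y _ _ hxy ε hε
      filter_upwards [hxy ε hε] with n hn
      rwa [norm_sub_rev]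
  rcases K.eq_empty_or_nonempty with rfl | ⟨x₀, hx₀⟩
  · simp
  have hmain : ∀ᶠ n in atTop, ∀ x ∈ K, ‖F n x - F n x₀‖ < ε / 2 := by
    refine hK.induction_on (p := fun s => ∀ᶠ n in atTop, ∀ x ∈ s, ‖F n x - F n x₀‖ < ε / 2)
      (by simp) (fun s t hst ht => ?_) (fun s t hs ht => ?_) (fun x hx => ?_)
    · filter_upwards [ht] with n hn x hx using hn x (hst hx)
    · filter_upwards [hs, ht] with n h1 h2 x hx using hx.elim (h1 x) (h2 x)
    · obtain ⟨V, hV, h⟩ := hloc x (hKU hx)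
      refine ⟨V, mem_nhdsWithin_of_mem_nhds hV, ?_⟩
      filter_upwards [h (ε / 4) (by linarith),
        hP x₀ (hKU hx₀) x (hKU hx) (ε / 4) (by linarith)] with n h1 h2 y hy
      linarith [norm_sub_le_norm_sub_add_norm_sub (F n y) (F n x) (F n x₀), h1 y hy]
  filter_upwards [hmain] with n hn x hx y hy
  have h2 := hn y hy
  rw [norm_sub_rev] at h2
  linarith [norm_sub_le_norm_sub_add_norm_sub (F n x) (F n x₀) (F n y), hn x hx]

end DisjointImages

/-! ### Flat labellings of a planar grid -/

section Grid

variable {G : Type*}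

/-- Two labellings of the edges of the grid `ℕ × ℕ` have the same labels on the four edges of the
square with lower left corner `s`. The label `h i j` belongs to the edge from `(i, j)` to
`(i + 1, j)`, the label `v i j` to the edge from `(i, j)` to `(i, j + 1)`. -/
def AgreeOn (h v h' v' : ℕ → ℕ → G) (s : ℕ × ℕ) : Prop :=
  h' s.1 s.2 = h s.1 s.2 ∧ h' s.1 (s.2 + 1) = h s.1 (s.2 + 1) ∧
    v' s.1 s.2 = v s.1 s.2 ∧ v' (s.1 + 1) s.2 = v (s.1 + 1) s.2

lemma AgreeOn.trans {h v h' v' h'' v'' : ℕ → ℕ → G} {s : ℕ × ℕ} (h₁ : AgreeOn h v h' v' s)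
    (h₂ : AgreeOn h' v' h'' v'' s) : AgreeOn h v h'' v'' s :=
  ⟨h₂.1.trans h₁.1, h₂.2.1.trans h₁.2.1, h₂.2.2.1.trans h₁.2.2.1, h₂.2.2.2.trans h₁.2.2.2⟩

variable [Group G]

/-- A labelling with values in a group is flat on the square `s` if the products of the labels along
the two monotone paths from the lower left corner to the upper right corner agree. -/
def FlatOn (h v : ℕ → ℕ → G) (s : ℕ × ℕ) : Prop :=
  v (s.1 + 1) s.2 * h s.1 s.2 = h s.1 (s.2 + 1) * v s.1 s.2

lemma FlatOn.of_agreeOn {h v h' v' : ℕ → ℕ → G} {s : ℕ × ℕ} (hs : FlatOn h v s)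
    (ha : AgreeOn h v h' v' s) : FlatOn h' v' s := by
  obtain ⟨h1, h2, h3, h4⟩ := ha
  rw [FlatOn, h1, h2, h3, h4]
  exact hs

/-- Two squares of the grid share an edge. -/
def SquareAdj (s t : ℕ × ℕ) : Prop :=
  (t.1 = s.1 + 1 ∧ t.2 = s.2) ∨ (s.1 = t.1 + 1 ∧ t.2 = s.2) ∨
    (t.1 = s.1 ∧ t.2 = s.2 + 1) ∨ (t.1 = s.1 ∧ s.2 = t.2 + 1)

lemma SquareAdj.symm {s t : ℕ × ℕ} (h : SquareAdj s t) : SquareAdj t s := by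
  simp only [SquareAdj] at *; omega

/-- The square `s` is joined to the outside of the box `[0, n] × [0, n]` by a chain of squares from
`Q` in which consecutive squares share an edge. -/
inductive Escapes (Q : Set (ℕ × ℕ)) (n : ℕ) : ℕ × ℕ → Prop
  | outside {s : ℕ × ℕ} : s ∈ Q → (n ≤ s.1 ∨ n ≤ s.2) → Escapes Q n s
  | step {s t : ℕ × ℕ} : s ∈ Q → SquareAdj s t → Escapes Q n t → Escapes Q n s

/-- A labelling can be made flat on a square by changing the label of any one of its edges. -/
lemma exists_flatOn_of_squareAdj (h v : ℕ → ℕ → G) {s t : ℕ × ℕ} (hst : SquareAdj s t) :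
    ∃ h' v' : ℕ → ℕ → G, FlatOn h' v' s ∧ ∀ u, u ≠ s → u ≠ t → AgreeOn h v h' v' u := by
  obtain ⟨i, j⟩ := s
  obtain ⟨k, l⟩ := t
  rcases hst with ⟨h1, h2⟩ | ⟨h1, h2⟩ | ⟨h1, h2⟩ | ⟨h1, h2⟩ <;> dsimp only at h1 h2 <;> subst h1 h2
  · refine ⟨h, fun a b => if a = i + 1 ∧ b = l then h i (l + 1) * v i l * (h i l)⁻¹ else v a b,
      ?_, ?_⟩
    · simp [FlatOn]
    · rintro ⟨a, b⟩ h1 h2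
      simp only [ne_eq, Prod.mk.injEq] at h1 h2
      refine ⟨rfl, rfl, if_neg (by dsimp; omega), if_neg (by dsimp; omega)⟩
  · refine ⟨h, fun a b => if a = k + 1 ∧ b = l then
      (h (k + 1) (l + 1))⁻¹ * v (k + 1 + 1) l * h (k + 1) l else v a b, ?_, ?_⟩
    · simp [FlatOn, mul_assoc]
    · rintro ⟨a, b⟩ h1 h2
      simp only [ne_eq, Prod.mk.injEq] at h1 h2
      refine ⟨rfl, rfl, if_neg (by dsimp; omega), if_neg (by dsimp; omega)⟩
  · refine ⟨fun a b => if a = k ∧ b = j + 1 then v (k + 1) j * h k j * (v k j)⁻¹ else h a b, v,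
      ?_, ?_⟩
    · simp [FlatOn]
    · rintro ⟨a, b⟩ h1 h2
      simp only [ne_eq, Prod.mk.injEq] at h1 h2
      refine ⟨if_neg (by dsimp; omega), if_neg (by dsimp; omega), rfl, rfl⟩
  · refine ⟨fun a b => if a = k ∧ b = l + 1 then
      (v (k + 1) (l + 1))⁻¹ * h k (l + 1 + 1) * v k (l + 1) else h a b, v, ?_, ?_⟩
    · simp [FlatOn, mul_assoc]
    · rintro ⟨a, b⟩ h1 h2
      simp only [ne_eq, Prod.mk.injEq] at h1 h2
      refine ⟨if_neg (by dsimp; omega), if_neg (by dsimp; omega), rfl, rfl⟩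

/-- The defect of flatness of a labelling at a square that escapes from the box can be pushed along
the chain out of the box. -/
lemma Escapes.exists_flatOn {Q : Set (ℕ × ℕ)} {n : ℕ} {s : ℕ × ℕ} (hs : Escapes Q n s) :
    ∀ (h v : ℕ → ℕ → G) (B : Set (ℕ × ℕ)),
      (∀ t : ℕ × ℕ, t.1 < n → t.2 < n → t ∉ B → t ≠ s → FlatOn h v t) →
      ∃ h' v' : ℕ → ℕ → G, (∀ t, ¬ Escapes Q n t → AgreeOn h v h' v' t) ∧
        ∀ t : ℕ × ℕ, t.1 < n → t.2 < n → t ∉ B ∨ t = s → FlatOn h' v' t := by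
  induction hs with
  | @outside s hs ho =>
    intro h v B hB
    refine ⟨h, v, fun _ _ => ⟨rfl, rfl, rfl, rfl⟩, fun t h1 h2 ht => ?_⟩
    have hts : t ≠ s := by rintro rfl; omega
    exact hB t h1 h2 (ht.resolve_right hts) hts
  | @step s t hs hst ht ih =>
    intro h v B hB
    obtain ⟨h₁, v₁, hflat, hagree⟩ := exists_flatOn_of_squareAdj h v hst
    obtain ⟨h₂, v₂, hagree', hflat'⟩ := ih h₁ v₁ (B \ {s}) fun u h1 h2 huB hut => by
      by_cases hus : u = s
      · exact hus ▸ hflat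
      · exact (hB u h1 h2 (fun hu => huB ⟨hu, hus⟩) hus).of_agreeOn (hagree u hus hut)
    refine ⟨h₂, v₂, fun u hu => (hagree u ?_ ?_).trans (hagree' u hu), fun u h1 h2 hu => ?_⟩
    · rintro rfl; exact hu (.step hs hst ht)
    · rintro rfl; exact hu ht
    · refine hflat' u h1 h2 (Or.inl ?_)
      rintro ⟨h3, h4⟩
      exact hu.elim (fun h => h h3) h4

/-- A labelling that is flat on every square of the box is a coboundary there. -/
lemma exists_potential_of_flatOn (h v : ℕ → ℕ → G) (n : ℕ)
    (hflat : ∀ t : ℕ × ℕ, t.1 < n → t.2 < n → FlatOn h v t) :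
    ∃ b : ℕ → ℕ → G, (∀ i j, i < n → j ≤ n → b (i + 1) j = h i j * b i j) ∧
      ∀ i j, b i (j + 1) = v i j * b i j := by
  let c : ℕ → G := fun i => Nat.rec 1 (fun i x => h i 0 * x) i
  let b : ℕ → ℕ → G := fun i j => Nat.rec (c i) (fun j x => v i j * x) j
  refine ⟨b, fun i j hi => ?_, fun i j => rfl⟩
  induction j with
  | zero => intro _; rfl
  | succ j ih =>
    intro hj
    change v (i + 1) j * b (i + 1) j = h i (j + 1) * (v i j * b i j)
    have := hflat (i, j) hi (by dsimp; omega)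
    dsimp only [FlatOn] at this
    rw [ih (by omega), ← mul_assoc, this, mul_assoc]

/-- A labelling that is flat on all squares that do not escape from the box is a coboundary on these
squares. This is the vanishing of the first cohomology, with nonabelian coefficients, of a planar
region whose complement is connected. -/
lemma exists_potential (Q : Set (ℕ × ℕ)) (n : ℕ)
    (hQ : ∀ s : ℕ × ℕ, n ≤ s.1 ∨ n ≤ s.2 → s ∈ Q) (h v : ℕ → ℕ → G)
    (hflat : ∀ s, ¬ Escapes Q n s → FlatOn h v s) :
    ∃ b : ℕ → ℕ → G, ∀ i j, ¬ Escapes Q n (i, j) →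
      b (i + 1) j = h i j * b i j ∧ b i (j + 1) = v i j * b i j ∧
      b (i + 1) (j + 1) = h i (j + 1) * b i (j + 1) := by
  have key : ∀ B : Finset (ℕ × ℕ), (∀ s ∈ B, Escapes Q n s) → ∀ h v : ℕ → ℕ → G,
      (∀ t : ℕ × ℕ, t.1 < n → t.2 < n → t ∉ B → FlatOn h v t) →
      ∃ h' v' : ℕ → ℕ → G, (∀ t, ¬ Escapes Q n t → AgreeOn h v h' v' t) ∧
        ∀ t : ℕ × ℕ, t.1 < n → t.2 < n → FlatOn h' v' t := by
    intro B
    induction B using Finset.induction_on with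
    | empty => exact fun _ h v hf => ⟨h, v, fun _ _ => ⟨rfl, rfl, rfl, rfl⟩, by simpa using hf⟩
    | insert s B hs ih =>
      intro hB h v hf
      obtain ⟨h₁, v₁, ha, hf₁⟩ := (hB s (Finset.mem_insert_self s B)).exists_flatOn h v
        (B : Set (ℕ × ℕ)) fun t h1 h2 h3 h4 => hf t h1 h2 (by simpa [h4] using h3)
      obtain ⟨h₂, v₂, ha', hf₂⟩ := ih (fun t ht => hB t (Finset.mem_insert_of_mem ht)) h₁ v₁
        fun t h1 h2 h3 => hf₁ t h1 h2 (Or.inl (by simpa using h3))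
      exact ⟨h₂, v₂, fun t ht => (ha t ht).trans (ha' t ht), hf₂⟩
  classical
  obtain ⟨h', v', ha, hf⟩ := key
    ((Finset.range n ×ˢ Finset.range n).filter fun s => Escapes Q n s)
    (fun s hs => (Finset.mem_filter.1 hs).2) h v fun t h1 h2 ht => hflat t fun hE =>
      ht (Finset.mem_filter.2 ⟨by simp [h1, h2], hE⟩)
  obtain ⟨b, hb₁, hb₂⟩ := exists_potential_of_flatOn h' v' n hf
  refine ⟨b, fun i j hE => ?_⟩
  obtain ⟨e1, e2, e3, e4⟩ := ha _ hE
  dsimp only at e1 e2 e3 e4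
  have hin : i < n ∧ j < n := by
    by_contra hcon
    have : n ≤ i ∨ n ≤ j := by omega
    exact hE (.outside (hQ (i, j) this) this)
  exact ⟨by rw [hb₁ i j hin.1 hin.2.le, e1], by rw [hb₂, e3],
    by rw [hb₁ i (j + 1) hin.1 hin.2, e2]⟩

end Grid

/-! ### Lifting maps from grid regions to covering spaces -/

section Lift

variable {Y Z : Type*} [TopologicalSpace Y] [TopologicalSpace Z] {π : Y → Z}

lemma exists_lift_of_convex (hπ : IsCoveringMap π) {s : Set ℂ} (hs : Convex ℝ s) {g : ℂ → Z}
    (hg : ContinuousOn g s) {w : ℂ} (hw : w ∈ s) {y : Y} (hy : π y = g w) :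
    ∃ l : ℂ → Y, ContinuousOn l s ∧ (∀ u ∈ s, π (l u) = g u) ∧ l w = y := by
  have := hs.contractibleSpace ⟨w, hw⟩
  have := hs.locallyPathConnectedSpace ℂ
  obtain ⟨L, ⟨hL1, hL2⟩, -⟩ := hπ.existsUnique_continuousMap_lifts
    ⟨s.domRestrict g, hg.domRestrict⟩ ⟨w, hw⟩ y hy
  classical
  have hval : ∀ u : s, (fun u : ℂ => if hu : u ∈ s then L ⟨u, hu⟩ else y) u = L u := fun u => by
    simp
  refine ⟨fun u => if hu : u ∈ s then L ⟨u, hu⟩ else y, ?_, fun u hu => ?_, ?_⟩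
  · rw [continuousOn_iff_continuous_domRestrict]
    exact L.continuous.congr fun u => (hval u).symm
  · simpa [hu] using congrFun hL2 ⟨u, hu⟩
  · simpa [hw] using hL1

/-- The transport between the fibres over two points of a convex set, along lifts over this set. -/
lemma exists_transport (hπ : IsCoveringMap π) {s : Set ℂ} (hs : Convex ℝ s) {g : ℂ → Z}
    (hg : ContinuousOn g s) {a b : ℂ} (ha : a ∈ s) (hb : b ∈ s) :
    ∃ e : π ⁻¹' {g a} ≃ π ⁻¹' {g b}, ∀ l : ℂ → Y, ContinuousOn l s → (∀ u ∈ s, π (l u) = g u) →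
      ∀ y : π ⁻¹' {g a}, (y : Y) = l a → (e y : Y) = l b := by
  have huniq : ∀ l l' : ℂ → Y, ContinuousOn l s → ContinuousOn l' s → (∀ u ∈ s, π (l u) = g u) →
      (∀ u ∈ s, π (l' u) = g u) → ∀ c ∈ s, l c = l' c → EqOn l l' s :=
    fun l l' h1 h2 h3 h4 c hc h => hπ.eqOn_of_comp_eqOn hs.isPreconnected h1 h2
      (fun u hu => (h3 u hu).trans (h4 u hu).symm) hc h
  have hex : ∀ c ∈ s, ∀ y : π ⁻¹' {g c}, ∃ l : ℂ → Y, ContinuousOn l s ∧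
      (∀ u ∈ s, π (l u) = g u) ∧ l c = y := fun c hc y => exists_lift_of_convex hπ hs hg hc y.2
  choose la hla1 hla2 hla3 using hex a ha
  choose lb hlb1 hlb2 hlb3 using hex b hb
  refine ⟨⟨fun y => ⟨la y b, hla2 y b hb⟩, fun y => ⟨lb y a, hlb2 y a ha⟩, fun y => ?_,
    fun y => ?_⟩, fun l hl1 hl2 y hy => ?_⟩
  · refine Subtype.ext ?_
    dsimp only
    rw [← hla3 y]
    exact huniq _ _ (hlb1 _) (hla1 _) (hlb2 _) (hla2 _) b hb (hlb3 _) ha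
  · refine Subtype.ext ?_
    dsimp only
    rw [← hlb3 y]
    exact huniq _ _ (hla1 _) (hlb1 _) (hla2 _) (hlb2 _) a ha (hla3 _) hb
  · exact huniq _ _ (hla1 _) hl1 (hla2 _) hl2 a ha ((hla3 y).trans hy) hb

/-- The vertices of the square grid with mesh `η` and lower left corner `c`. -/
def gridVertex (c : ℂ) (η : ℝ) (i j : ℕ) : ℂ := ⟨c.re + η * i, c.im + η * j⟩

/-- The closed squares of the square grid with mesh `η` and lower left corner `c`. -/
def gridSquare (c : ℂ) (η : ℝ) (s : ℕ × ℕ) : Set ℂ :=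
  Icc (c.re + η * s.1) (c.re + η * (s.1 + 1)) ×ℂ Icc (c.im + η * s.2) (c.im + η * (s.2 + 1))

lemma mem_gridSquare {c : ℂ} {η : ℝ} {s : ℕ × ℕ} {z : ℂ} : z ∈ gridSquare c η s ↔
    (c.re + η * s.1 ≤ z.re ∧ z.re ≤ c.re + η * (s.1 + 1)) ∧
      (c.im + η * s.2 ≤ z.im ∧ z.im ≤ c.im + η * (s.2 + 1)) := Iff.rfl

lemma convex_gridSquare (c : ℂ) (η : ℝ) (s : ℕ × ℕ) : Convex ℝ (gridSquare c η s) :=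
  ((convex_Icc _ _).linear_preimage Complex.reLm).inter
    ((convex_Icc _ _).linear_preimage Complex.imLm)

lemma isClosed_gridSquare (c : ℂ) (η : ℝ) (s : ℕ × ℕ) : IsClosed (gridSquare c η s) :=
  isClosed_Icc.reProdIm isClosed_Icc

lemma gridVertex_mem_gridSquare {c : ℂ} {η : ℝ} (hη : 0 < η) {s : ℕ × ℕ} {i j : ℕ}
    (hi : i = s.1 ∨ i = s.1 + 1) (hj : j = s.2 ∨ j = s.2 + 1) :
    gridVertex c η i j ∈ gridSquare c η s := by
  rw [mem_gridSquare]
  rcases hi with rfl | rfl <;> rcases hj with rfl | rfl <;> simp [gridVertex] <;>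
    constructor <;> nlinarith

/-- Two squares of the grid that intersect have a common corner. -/
lemma exists_common_corner {c : ℂ} {η : ℝ} (hη : 0 < η) {s t : ℕ × ℕ} {z : ℂ}
    (hs : z ∈ gridSquare c η s) (ht : z ∈ gridSquare c η t) :
    ∃ i j : ℕ, (i = s.1 ∨ i = s.1 + 1) ∧ (j = s.2 ∨ j = s.2 + 1) ∧
      (i = t.1 ∨ i = t.1 + 1) ∧ (j = t.2 ∨ j = t.2 + 1) := by
  obtain ⟨⟨a1, a2⟩, a3, a4⟩ := mem_gridSquare.1 hs
  obtain ⟨⟨b1, b2⟩, b3, b4⟩ := mem_gridSquare.1 ht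
  have key : ∀ (x y : ℝ) (k l : ℕ), x + η * k ≤ y → y ≤ x + η * (l + 1) → k ≤ l + 1 := by
    intro x y k l h1 h2
    have h3 : η * k ≤ η * (l + 1) := by linarith
    exact_mod_cast le_of_mul_le_mul_left h3 hη
  have k1 := key _ _ _ _ a1 b2
  have k2 := key _ _ _ _ b1 a2
  have k3 := key _ _ _ _ a3 b4
  have k4 := key _ _ _ _ b3 a4
  exact ⟨max s.1 t.1, max s.2 t.2, by omega, by omega, by omega, by omega⟩

/-- The union of the squares of the grid that do not escape from the box. -/
def gridRegion (c : ℂ) (η : ℝ) (Q : Set (ℕ × ℕ)) (n : ℕ) : Set ℂ :=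
  ⋃ s : {s // ¬ Escapes Q n s}, gridSquare c η s

/-- A grid region whose complementary squares all escape to the outside behaves like a simply
connected space: a map from it to the base of a covering lifts, with a prescribed value at one
point. The fibres are assumed to be equipotent, so that the transport along an edge of the grid
becomes a permutation of the model fibre `F`. -/
theorem exists_lift_gridRegion (hπ : IsCoveringMap π) {F : Type*}
    (hF : ∀ z, Nonempty (F ≃ π ⁻¹' {z})) {c : ℂ} {η : ℝ} (hη : 0 < η) {Q : Set (ℕ × ℕ)} {n : ℕ}
    (hQ : ∀ s : ℕ × ℕ, n ≤ s.1 ∨ n ≤ s.2 → s ∈ Q) {g : ℂ → Z}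
    (hg : ContinuousOn g (gridRegion c η Q n)) {w : ℂ} (hw : w ∈ gridRegion c η Q n) {y : Y}
    (hy : π y = g w) :
    ∃ l : ℂ → Y, ContinuousOn l (gridRegion c η Q n) ∧
      (∀ u ∈ gridRegion c η Q n, π (l u) = g u) ∧ l w = y := by
  classical
  set P : Set (ℕ × ℕ) := {s | ¬ Escapes Q n s} with hP
  have hgs : ∀ s ∈ P, ContinuousOn g (gridSquare c η s) := fun s hs =>
    hg.mono (subset_iUnion (fun s : {s // ¬ Escapes Q n s} => gridSquare c η s) ⟨s, hs⟩)
  have hinter : ∀ s ∈ P, ∀ t ∈ P, ∀ l l' : ℂ → Y, ContinuousOn l (gridSquare c η s) →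
      ContinuousOn l' (gridSquare c η t) → (∀ u ∈ gridSquare c η s, π (l u) = g u) →
      (∀ u ∈ gridSquare c η t, π (l' u) = g u) → ∀ a, a ∈ gridSquare c η s →
      a ∈ gridSquare c η t → l a = l' a → ∀ b, b ∈ gridSquare c η s → b ∈ gridSquare c η t →
      l b = l' b := by
    intro s hs t ht l l' h1 h2 h3 h4 a has hat hab b hbs hbt
    exact hπ.eqOn_of_comp_eqOn
      ((convex_gridSquare c η s).inter (convex_gridSquare c η t)).isPreconnected
      (h1.mono inter_subset_left) (h2.mono inter_subset_right)
      (fun u hu => (h3 u hu.1).trans (h4 u hu.2).symm) ⟨has, hat⟩ hab ⟨hbs, hbt⟩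
  have τ : ∀ z, F ≃ π ⁻¹' {z} := fun z => (hF z).some
  -- the transport along an edge, read in the trivializations `τ` of the fibres at its ends
  have hlab : ∀ a b : ℂ, ∃ e : Equiv.Perm F, ∀ s ∈ P, a ∈ gridSquare c η s →
      b ∈ gridSquare c η s → ∀ l : ℂ → Y, ContinuousOn l (gridSquare c η s) →
      (∀ u ∈ gridSquare c η s, π (l u) = g u) → ∀ x : F, (τ (g a) x : Y) = l a →
      (τ (g b) (e x) : Y) = l b := by
    intro a b
    by_cases H : ∃ s ∈ P, a ∈ gridSquare c η s ∧ b ∈ gridSquare c η s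
    · obtain ⟨t, ht, hat, hbt⟩ := H
      obtain ⟨e, he⟩ := exists_transport hπ (convex_gridSquare c η t) (hgs t ht) hat hbt
      refine ⟨((τ (g a)).trans e).trans (τ (g b)).symm, fun s hs has hbs l hl1 hl2 x hx => ?_⟩
      obtain ⟨l', hl1', hl2', hl3'⟩ := exists_lift_of_convex hπ (convex_gridSquare c η t)
        (hgs t ht) hat (y := l a) (hl2 a has)
      have h1 := he l' hl1' hl2' (τ (g a) x) (hx.trans hl3'.symm)
      simp only [Equiv.trans_apply, Equiv.apply_symm_apply]
      rw [h1]
      exact (hinter s hs t ht l l' hl1 hl1' hl2 hl2' a has hat hl3'.symm b hbs hbt).symm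
    · exact ⟨1, fun s hs has hbs => (H ⟨s, hs, has, hbs⟩).elim⟩
  choose lab hlab using hlab
  set vtx := gridVertex c η with hvtx
  set h : ℕ → ℕ → Equiv.Perm F := fun i j => lab (vtx i j) (vtx (i + 1) j) with hh
  set v : ℕ → ℕ → Equiv.Perm F := fun i j => lab (vtx i j) (vtx i (j + 1)) with hv
  have hmem : ∀ (s : ℕ × ℕ) (i j : ℕ), (i = s.1 ∨ i = s.1 + 1) → (j = s.2 ∨ j = s.2 + 1) →
      vtx i j ∈ gridSquare c η s := fun s i j hi hj => gridVertex_mem_gridSquare hη hi hj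
  have hflat : ∀ s, ¬ Escapes Q n s → FlatOn h v s := by
    intro s hs
    obtain ⟨i, j⟩ := s
    refine Equiv.ext fun x => ?_
    have m00 := hmem (i, j) i j (by simp) (by simp)
    have m10 := hmem (i, j) (i + 1) j (by simp) (by simp)
    have m01 := hmem (i, j) i (j + 1) (by simp) (by simp)
    have m11 := hmem (i, j) (i + 1) (j + 1) (by simp) (by simp)
    obtain ⟨l, hl1, hl2, hl3⟩ := exists_lift_of_convex hπ (convex_gridSquare c η (i, j))
      (hgs (i, j) hs) m00 (y := τ (g (vtx i j)) x) (τ (g (vtx i j)) x).2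
    have e1 := hlab _ _ (i, j) hs m00 m10 l hl1 hl2 x hl3.symm
    have e2 := hlab _ _ (i, j) hs m10 m11 l hl1 hl2 _ e1
    have e3 := hlab _ _ (i, j) hs m00 m01 l hl1 hl2 x hl3.symm
    have e4 := hlab _ _ (i, j) hs m01 m11 l hl1 hl2 _ e3
    exact (τ _).injective (Subtype.ext (e2.trans e4.symm))
  obtain ⟨b, hb⟩ := exists_potential Q n hQ h v hflat
  obtain ⟨⟨s₀, hs₀⟩, hws₀⟩ := mem_iUnion.1 hw
  obtain ⟨l₀, hl₀1, hl₀2, hl₀3⟩ := exists_lift_of_convex hπ (convex_gridSquare c η s₀)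
    (hgs s₀ hs₀) hws₀ hy
  have m₀ := hmem s₀ s₀.1 s₀.2 (by simp) (by simp)
  set x : F := (b s₀.1 s₀.2)⁻¹ ((τ (g (vtx s₀.1 s₀.2))).symm ⟨l₀ (vtx s₀.1 s₀.2), hl₀2 _ m₀⟩)
    with hx
  set σ : ℕ → ℕ → Y := fun i j => τ (g (vtx i j)) (b i j x) with hσ
  have hσ₀ : σ s₀.1 s₀.2 = l₀ (vtx s₀.1 s₀.2) := by
    simp [hσ, hx]
  have hex : ∀ s : {s // ¬ Escapes Q n s}, ∃ l : ℂ → Y, ContinuousOn l (gridSquare c η s) ∧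
      (∀ u ∈ gridSquare c η s, π (l u) = g u) ∧ l (vtx s.1.1 s.1.2) = σ s.1.1 s.1.2 := fun s =>
    exists_lift_of_convex hπ (convex_gridSquare c η s) (hgs s s.2)
      (hmem s _ _ (by simp) (by simp)) (τ _ _).2
  choose l hl1 hl2 hl3 using hex
  have hcorner : ∀ (s : {s // ¬ Escapes Q n s}) (i j : ℕ), (i = s.1.1 ∨ i = s.1.1 + 1) →
      (j = s.1.2 ∨ j = s.1.2 + 1) → l s (vtx i j) = σ i j := by
    rintro ⟨⟨i, j⟩, hs⟩ i' j' hi hj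
    set s : {s // ¬ Escapes Q n s} := ⟨(i, j), hs⟩
    have m00 := hmem (i, j) i j (by simp) (by simp)
    have m10 := hmem (i, j) (i + 1) j (by simp) (by simp)
    have m01 := hmem (i, j) i (j + 1) (by simp) (by simp)
    have m11 := hmem (i, j) (i + 1) (j + 1) (by simp) (by simp)
    obtain ⟨b1, b2, b3⟩ := hb i j hs
    have e0 : (τ (g (vtx i j)) (b i j x) : Y) = l s (vtx i j) := (hl3 s).symm
    have e1 := hlab _ _ (i, j) hs m00 m10 (l s) (hl1 s) (hl2 s) _ e0
    have e2 := hlab _ _ (i, j) hs m00 m01 (l s) (hl1 s) (hl2 s) _ e0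
    have e3 := hlab _ _ (i, j) hs m01 m11 (l s) (hl1 s) (hl2 s) _ e2
    rcases hi with rfl | rfl <;> rcases hj with rfl | rfl <;> dsimp only [s, hσ]
    · exact e0.symm
    · rw [hσ]; dsimp only; rw [b2]; exact e2.symm
    · rw [hσ]; dsimp only; rw [b1]; exact e1.symm
    · rw [hσ]; dsimp only; rw [b3, b2]; exact e3.symm
  have hagree : ∀ (s t : {s // ¬ Escapes Q n s}) (u : ℂ), u ∈ gridSquare c η s →
      u ∈ gridSquare c η t → l s u = l t u := by
    intro s t u hus hut
    obtain ⟨i, j, h1, h2, h3, h4⟩ := exists_common_corner hη hus hut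
    exact hinter s s.2 t t.2 (l s) (l t) (hl1 s) (hl1 t) (hl2 s) (hl2 t) (vtx i j)
      (hmem s i j h1 h2) (hmem t i j h3 h4) ((hcorner s i j h1 h2).trans (hcorner t i j h3 h4).symm)
      u hus hut
  set L : ℂ → Y := fun u => if H : ∃ s : {s // ¬ Escapes Q n s}, u ∈ gridSquare c η s
    then l H.choose u else y with hL
  have hLs : ∀ s : {s // ¬ Escapes Q n s}, EqOn L (l s) (gridSquare c η s) := by
    intro s u hu
    have H : ∃ s : {s // ¬ Escapes Q n s}, u ∈ gridSquare c η s := ⟨s, hu⟩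
    rw [hL]
    dsimp only
    rw [dif_pos H]
    exact hagree _ _ _ H.choose_spec hu
  have hfin : Finite {s // ¬ Escapes Q n s} := by
    refine ((Finset.range n ×ˢ Finset.range n).finite_toSet.subset fun s hs => ?_).to_subtype
    by_contra hcon
    have : n ≤ s.1 ∨ n ≤ s.2 := by
      simp only [Finset.coe_product, mem_prod, Finset.mem_coe, Finset.mem_range] at hcon
      omega
    exact hs (.outside (hQ s this) this)
  refine ⟨L, ?_, ?_, ?_⟩
  · exact (locallyFinite_of_finite _).continuousOn_iUnion (fun s => isClosed_gridSquare c η s)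
      fun s => (hl1 s).congr (hLs s)
  · intro u hu
    obtain ⟨s, hus⟩ := mem_iUnion.1 hu
    rw [hLs s hus, hl2 s u hus]
  · rw [hLs ⟨s₀, hs₀⟩ hws₀, ← hl₀3]
    exact hinter s₀ hs₀ s₀ hs₀ (l ⟨s₀, hs₀⟩) l₀ (hl1 ⟨s₀, hs₀⟩) hl₀1 (hl2 ⟨s₀, hs₀⟩) hl₀2
      (vtx s₀.1 s₀.2) m₀ m₀ ((hl3 ⟨s₀, hs₀⟩).trans hσ₀) w hws₀ hws₀

end Lift

/-! ### Grid neighbourhoods of compact sets that do not separate -/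

/-- A compact subset of a domain in the plane is contained in a compact connected subset. -/
lemma exists_isCompact_isPreconnected {V C₀ : Set ℂ} (hVo : IsOpen V) (hV : IsPreconnected V)
    (hC₀ : IsCompact C₀) (hC₀V : C₀ ⊆ V) :
    ∃ C, IsCompact C ∧ IsPreconnected C ∧ C₀ ⊆ C ∧ C ⊆ V := by
  have hball : ∀ x ∈ V, ∃ r > 0, Metric.closedBall x r ⊆ V := fun x hx =>
    Metric.nhds_basis_closedBall.mem_iff.1 (hVo.mem_nhds hx)
  have hpc : ∀ (x : ℂ) (r : ℝ), IsPreconnected (Metric.closedBall x r) := fun x r =>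
    (convex_closedBall x r).isPreconnected
  let P : ℂ → ℂ → Prop := fun x y => ∃ C, IsCompact C ∧ IsPreconnected C ∧ C ⊆ V ∧ x ∈ C ∧ y ∈ C
  have hP : ∀ x ∈ V, ∀ y ∈ V, P x y := by
    intro x hx y hy
    refine hV.induction₂ P (fun x hx => ?_) ?_ ?_ hx hy
    · obtain ⟨r, hr, hrV⟩ := hball x hx
      filter_upwards [mem_nhdsWithin_of_mem_nhds (Metric.closedBall_mem_nhds x hr)] with y hy
      exact ⟨_, isCompact_closedBall x r, hpc x r, hrV, Metric.mem_closedBall_self hr.le, hy⟩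
    · rintro x y z - - - ⟨C, h1, h2, h3, h4, h5⟩ ⟨D, k1, k2, k3, k4, k5⟩
      exact ⟨C ∪ D, h1.union k1, h2.union y h5 k4 k2, union_subset h3 k3, Or.inl h4, Or.inr k5⟩
    · rintro x y - - ⟨C, h1, h2, h3, h4, h5⟩
      exact ⟨C, h1, h2, h3, h5, h4⟩
  rcases C₀.eq_empty_or_nonempty with rfl | ⟨x₀, hx₀⟩
  · exact ⟨∅, isCompact_empty, isPreconnected_empty, Subset.rfl, empty_subset _⟩
  suffices ∃ C, IsCompact C ∧ IsPreconnected C ∧ C ⊆ V ∧ x₀ ∈ C ∧ C₀ ⊆ C by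
    obtain ⟨C, h1, h2, h3, -, h5⟩ := this
    exact ⟨C, h1, h2, h5, h3⟩
  refine hC₀.induction_on
    (p := fun s => ∃ C, IsCompact C ∧ IsPreconnected C ∧ C ⊆ V ∧ x₀ ∈ C ∧ s ⊆ C) ?_ ?_ ?_ ?_
  · exact ⟨{x₀}, isCompact_singleton, isPreconnected_singleton,
      singleton_subset_iff.2 (hC₀V hx₀), rfl, empty_subset _⟩
  · rintro s t hst ⟨C, h1, h2, h3, h4, h5⟩
    exact ⟨C, h1, h2, h3, h4, hst.trans h5⟩
  · rintro s t ⟨C, h1, h2, h3, h4, h5⟩ ⟨D, k1, k2, k3, k4, k5⟩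
    exact ⟨C ∪ D, h1.union k1, h2.union x₀ h4 k4 k2, union_subset h3 k3, Or.inl h4,
      union_subset_union h5 k5⟩
  · intro x hx
    obtain ⟨r, hr, hrV⟩ := hball x (hC₀V hx)
    obtain ⟨C, h1, h2, h3, h4, h5⟩ := hP x₀ (hC₀V hx₀) x (hC₀V hx)
    exact ⟨_, mem_nhdsWithin_of_mem_nhds (Metric.closedBall_mem_nhds x hr),
      C ∪ Metric.closedBall x r, h1.union (isCompact_closedBall x r),
      h2.union x h5 (Metric.mem_closedBall_self hr.le) (hpc x r), union_subset h3 hrV,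
      Or.inl h4, subset_union_right⟩

lemma locallyFinite_gridSquare (c : ℂ) {η : ℝ} (hη : 0 < η) : LocallyFinite (gridSquare c η) := by
  intro x
  refine ⟨Metric.ball x 1, Metric.ball_mem_nhds x one_pos, ?_⟩
  set N := ⌈max (x.re + 1 - c.re) (x.im + 1 - c.im) / η⌉₊ with hN
  refine (Finset.range (N + 1) ×ˢ Finset.range (N + 1)).finite_toSet.subset ?_
  rintro ⟨i, j⟩ ⟨z, hz, hzx⟩
  obtain ⟨⟨a1, -⟩, a2, -⟩ := mem_gridSquare.1 hz
  rw [Metric.mem_ball, dist_eq_norm] at hzx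
  have h1 := (abs_le.1 ((Complex.abs_re_le_norm (z - x)).trans hzx.le)).2
  have h2 := (abs_le.1 ((Complex.abs_im_le_norm (z - x)).trans hzx.le)).2
  simp only [Complex.sub_re, Complex.sub_im] at h1 h2
  dsimp only at a1 a2
  have h3 : max (x.re + 1 - c.re) (x.im + 1 - c.im) ≤ N * η := by
    rw [← div_le_iff₀ hη]; exact Nat.le_ceil _
  have h4 := (le_max_left _ _).trans h3
  have h5 := (le_max_right _ _).trans h3
  have h6 : (i : ℝ) ≤ N := le_of_mul_le_mul_left (by linarith) hη
  have h7 : (j : ℝ) ≤ N := le_of_mul_le_mul_left (by linarith) hη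
  have h6' : i ≤ N := by exact_mod_cast h6
  have h7' : j ≤ N := by exact_mod_cast h7
  simp only [Finset.coe_product, Finset.coe_range, mem_prod, mem_Iio]
  omega

lemma exists_mem_gridSquare {c z : ℂ} {η : ℝ} (hη : 0 < η) (h1 : c.re ≤ z.re) (h2 : c.im ≤ z.im) :
    ∃ s, z ∈ gridSquare c η s := by
  have key : ∀ x y : ℝ, x ≤ y → x + η * ⌊(y - x) / η⌋₊ ≤ y ∧ y ≤ x + η * (⌊(y - x) / η⌋₊ + 1) := by
    intro x y hxy
    have k1 := Nat.floor_le (show 0 ≤ (y - x) / η from div_nonneg (by linarith) hη.le)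
    have k2 := (Nat.lt_floor_add_one ((y - x) / η)).le
    rw [le_div_iff₀ hη] at k1
    rw [div_le_iff₀ hη] at k2
    constructor <;> linarith
  exact ⟨(_, _), key _ _ h1, key _ _ h2⟩

lemma dist_le_of_mem_gridSquare {c z w : ℂ} {η : ℝ} {s : ℕ × ℕ} (hz : z ∈ gridSquare c η s)
    (hw : w ∈ gridSquare c η s) : dist z w ≤ 2 * η := by
  obtain ⟨⟨a1, a2⟩, a3, a4⟩ := mem_gridSquare.1 hz
  obtain ⟨⟨b1, b2⟩, b3, b4⟩ := mem_gridSquare.1 hw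
  rw [dist_eq_norm]
  have h1 : |(z - w).re| ≤ η := by
    rw [Complex.sub_re, abs_le]; constructor <;> linarith
  have h2 : |(z - w).im| ≤ η := by
    rw [Complex.sub_im, abs_le]; constructor <;> linarith
  linarith [Complex.norm_le_abs_re_add_abs_im (z - w)]

/-- Suppose that the complement of the open set `O` is contained in a connected open set `V` that
avoids the compact set `K` and reaches a point outside a disc around `K`. Then some fine grid
provides a region between `K` and `O` whose complementary squares all escape to the outside. -/
theorem exists_gridRegion {K O V : Set ℂ} {ρ : ℝ} (hρ : 0 ≤ ρ) (hK : IsCompact K)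
    (hKρ : K ⊆ Metric.closedBall 0 ρ) (hO : IsOpen O) (hVo : IsOpen V) (hV : IsPreconnected V)
    (hVK : V ⊆ Kᶜ) (hρV : ((ρ + 2 : ℝ) : ℂ) ∈ V) (hOV : Oᶜ ⊆ V) :
    ∃ (c : ℂ) (η : ℝ) (Q : Set (ℕ × ℕ)) (n : ℕ), 0 < η ∧
      (∀ s : ℕ × ℕ, n ≤ s.1 ∨ n ≤ s.2 → s ∈ Q) ∧
      K ⊆ gridRegion c η Q n ∧ gridRegion c η Q n ⊆ O := by
  set p : ℂ := ((ρ + 2 : ℝ) : ℂ) with hp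
  -- a connected compact set that joins the complement of `O`, as far as it matters, to `p`
  obtain ⟨C, hC, hCc, hC₀, hCV⟩ := exists_isCompact_isPreconnected hVo hV
    (C₀ := insert p (Oᶜ ∩ Metric.closedBall 0 (2 * ρ + 4)))
    (((isCompact_closedBall _ _).inter_left hO.isClosed_compl).insert p)
    (insert_subset hρV (inter_subset_left.trans hOV))
  obtain ⟨δ, hδ, hthick⟩ := hC.exists_thickening_subset_open hK.isClosed.isOpen_compl
    (hCV.trans hVK)
  set η : ℝ := min (δ / 4) (1 / 2) with hη
  have hη0 : 0 < η := by positivity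
  have hη1 : η ≤ 1 / 2 := min_le_right _ _
  have hηδ : 2 * η < δ := by linarith [min_le_left (δ / 4) (1 / 2 : ℝ)]
  set c : ℂ := ⟨-(ρ + 1), -(ρ + 1)⟩ with hc
  set Q : Set (ℕ × ℕ) := {s | Disjoint (gridSquare c η s) K} with hQ
  set n : ℕ := ⌈(2 * ρ + 2) / η⌉₊ with hn
  have hn1 : 2 * ρ + 2 ≤ η * n := by
    have := Nat.le_ceil ((2 * ρ + 2) / η)
    rw [div_le_iff₀ hη0] at this
    linarith
  have hn2 : η * n ≤ 2 * ρ + 2 + η := by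
    have := (Nat.ceil_lt_add_one (show 0 ≤ (2 * ρ + 2) / η by positivity)).le
    rw [← hn] at this
    calc η * n ≤ η * ((2 * ρ + 2) / η + 1) := by gcongr
      _ = 2 * ρ + 2 + η := by field_simp
  have hKre : ∀ z ∈ K, |z.re| ≤ ρ ∧ |z.im| ≤ ρ := fun z hz => by
    have := hKρ hz
    rw [mem_closedBall_zero_iff] at this
    exact ⟨(Complex.abs_re_le_norm z).trans this, (Complex.abs_im_le_norm z).trans this⟩
  have hcast : ∀ {k l : ℕ}, k ≤ l → η * (k : ℝ) ≤ η * l := fun h =>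
    mul_le_mul_of_nonneg_left (by exact_mod_cast h) hη0.le
  have hQout : ∀ s : ℕ × ℕ, n ≤ s.1 ∨ n ≤ s.2 → s ∈ Q := by
    intro s hs
    refine disjoint_left.2 fun z hz hzK => ?_
    obtain ⟨⟨a1, -⟩, a3, -⟩ := mem_gridSquare.1 hz
    obtain ⟨b1, b2⟩ := hKre z hzK
    simp only [hc] at a1 a3
    rcases hs with hs | hs
    · linarith [hcast hs, (abs_le.1 b1).2]
    · linarith [hcast hs, (abs_le.1 b2).2]
  have hQC : ∀ s, ∀ z ∈ C, z ∈ gridSquare c η s → s ∈ Q := by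
    intro s z hzC hzs
    refine disjoint_left.2 fun w hw hwK => ?_
    refine hthick (Metric.mem_thickening_iff.2 ⟨z, hzC, ?_⟩) hwK
    exact (dist_le_of_mem_gridSquare hw hzs).trans_lt hηδ
  -- the squares along the left and the lower side of the box escape
  have hleft : ∀ j, Escapes Q n (0, j) := by
    have hQ0 : ∀ j, (0, j) ∈ Q := by
      intro j
      refine disjoint_left.2 fun z hz hzK => ?_
      obtain ⟨⟨-, a2⟩, -, -⟩ := mem_gridSquare.1 hz
      obtain ⟨b1, -⟩ := hKre z hzK
      simp only [hc, Nat.cast_zero, zero_add, mul_one] at a2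
      linarith [(abs_le.1 b1).1]
    have : ∀ k j, n ≤ j + k → Escapes Q n (0, j) := by
      intro k
      induction k with
      | zero => exact fun j hj => .outside (hQ0 j) (Or.inr hj)
      | succ k ih =>
        exact fun j hj => .step (hQ0 j) (by simp [SquareAdj]) (ih (j + 1) (by omega))
    exact fun j => this n j (by omega)
  have hlower : ∀ i, Escapes Q n (i, 0) := by
    have hQ0 : ∀ i, (i, 0) ∈ Q := by
      intro i
      refine disjoint_left.2 fun z hz hzK => ?_
      obtain ⟨-, -, a2⟩ := mem_gridSquare.1 hz
      obtain ⟨-, b1⟩ := hKre z hzK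
      simp only [hc, Nat.cast_zero, zero_add, mul_one] at a2
      linarith [(abs_le.1 b1).1]
    have : ∀ k i, n ≤ i + k → Escapes Q n (i, 0) := by
      intro k
      induction k with
      | zero => exact fun i hi => .outside (hQ0 i) (Or.inl hi)
      | succ k ih =>
        exact fun i hi => .step (hQ0 i) (by simp [SquareAdj]) (ih (i + 1) (by omega))
    exact fun i => this n i (by omega)
  -- of the squares around a point of `C` either all or none escape
  have hstar : ∀ z ∈ C, ∀ s t, z ∈ gridSquare c η s → z ∈ gridSquare c η t → Escapes Q n s →
      Escapes Q n t := by
    rintro z hz ⟨i, j⟩ ⟨k, l⟩ hs ht hE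
    obtain ⟨a, b, e1, e2, e3, e4⟩ := exists_common_corner hη0 hs ht
    dsimp only at e1 e2 e3 e4
    have hu : z ∈ gridSquare c η (k, j) := ⟨ht.1, hs.2⟩
    have hEu : Escapes Q n (k, j) := by
      by_cases hki : k = i
      · exact hki ▸ hE
      · exact .step (hQC _ z hz hu) (by unfold SquareAdj; dsimp only; omega) hE
    by_cases hlj : l = j
    · exact hlj ▸ hEu
    · exact .step (hQC _ z hz ht) (by unfold SquareAdj; dsimp only; omega) hEu
  have hall : ∀ z ∈ C, ∀ s, z ∈ gridSquare c η s → Escapes Q n s := by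
    intro z hz
    have hpP : ∀ s, p ∈ gridSquare c η s → Escapes Q n s := by
      intro s hs
      obtain ⟨⟨-, a2⟩, -, -⟩ := mem_gridSquare.1 hs
      refine .outside (hQC s p (hC₀ (mem_insert _ _)) hs) (Or.inl ?_)
      simp only [hp, hc, Complex.ofReal_re] at a2
      have h1 : η * (n : ℝ) < η * (s.1 + 1) := by linarith
      have h2 : (n : ℝ) < s.1 + 1 := lt_of_mul_lt_mul_left h1 hη0.le
      have h3 : n < s.1 + 1 := by exact_mod_cast h2
      omega
    refine (hCc.induction₂ (fun x y => (∀ s, x ∈ gridSquare c η s → Escapes Q n s) ↔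
      (∀ s, y ∈ gridSquare c η s → Escapes Q n s)) (fun x hx => ?_)
      (fun _ _ _ _ _ _ h1 h2 => h1.trans h2) (fun _ _ _ _ h => h.symm)
      (hC₀ (mem_insert _ _)) hz).1 hpP
    have hnear : ∀ᶠ y in 𝓝 x, ∀ s, y ∈ gridSquare c η s → x ∈ gridSquare c η s := by
      filter_upwards [(locallyFinite_gridSquare c hη0).iInter_compl_mem_nhds
        (isClosed_gridSquare c η) x] with y hy s hys
      by_contra hxs
      simp only [mem_iInter] at hy
      exact hy s hxs hys
    by_cases hint : c.re < x.re ∧ c.im < x.im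
    · filter_upwards [mem_nhdsWithin_of_mem_nhds hnear, mem_nhdsWithin_of_mem_nhds
        (Complex.continuous_re.continuousAt.eventually_const_lt hint.1),
        mem_nhdsWithin_of_mem_nhds
        (Complex.continuous_im.continuousAt.eventually_const_lt hint.2)] with y hy h1 h2
      refine ⟨fun h s hs => h s (hy s hs), fun h s hs => ?_⟩
      obtain ⟨t, ht⟩ := exists_mem_gridSquare hη0 (le_of_lt h1) (le_of_lt h2)
      exact hstar x hx t s (hy t ht) hs (h t ht)
    · have hx' : ∀ s, x ∈ gridSquare c η s → Escapes Q n s := by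
        rintro ⟨i, j⟩ hs
        obtain ⟨⟨a1, -⟩, a3, -⟩ := mem_gridSquare.1 hs
        dsimp only at a1 a3
        rcases not_and_or.1 hint with h | h
        · have h1 : η * (i : ℝ) ≤ 0 := by linarith
          have h2 : (i : ℝ) ≤ 0 := nonpos_of_mul_nonpos_right h1 hη0
          have h3 : i = 0 := by exact_mod_cast le_antisymm h2 (Nat.cast_nonneg i)
          exact h3 ▸ hleft j
        · have h1 : η * (j : ℝ) ≤ 0 := by linarith
          have h2 : (j : ℝ) ≤ 0 := nonpos_of_mul_nonpos_right h1 hη0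
          have h3 : j = 0 := by exact_mod_cast le_antisymm h2 (Nat.cast_nonneg j)
          exact h3 ▸ hlower i
      filter_upwards [mem_nhdsWithin_of_mem_nhds hnear] with y hy
      exact ⟨fun h s hs => h s (hy s hs), fun _ => hx'⟩
  refine ⟨c, η, Q, n, hη0, hQout, fun z hz => ?_, fun z hz => ?_⟩
  · obtain ⟨b1, b2⟩ := hKre z hz
    obtain ⟨s, hs⟩ := exists_mem_gridSquare (c := c) (z := z) hη0
      (by simp only [hc]; linarith [(abs_le.1 b1).1]) (by simp only [hc]; linarith [(abs_le.1 b2).1])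
    have hsE : ¬ Escapes Q n s := by
      intro hE
      have : s ∈ Q := by cases hE <;> assumption
      exact disjoint_left.1 this hs hz
    exact mem_iUnion.2 ⟨⟨s, hsE⟩, hs⟩
  · obtain ⟨⟨s, hsE⟩, hs⟩ := mem_iUnion.1 hz
    by_contra hzO
    have hsn : s.1 < n ∧ s.2 < n := by
      by_contra hcon
      have : n ≤ s.1 ∨ n ≤ s.2 := by omega
      exact hsE (.outside (hQout s this) this)
    refine hsE (hall z (hC₀ (Or.inr ⟨hzO, ?_⟩)) s hs)
    obtain ⟨⟨a1, a2⟩, a3, a4⟩ := mem_gridSquare.1 hs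
    simp only [hc] at a1 a2 a3 a4
    have k1 := hcast (Nat.succ_le_of_lt hsn.1)
    have k2 := hcast (Nat.succ_le_of_lt hsn.2)
    push_cast at k1 k2
    have k3 : 0 ≤ η * (s.1 : ℝ) := by positivity
    have k4 : 0 ≤ η * (s.2 : ℝ) := by positivity
    rw [mem_closedBall_zero_iff]
    have h1 : |z.re| ≤ ρ + 2 := abs_le.2 ⟨by linarith, by linarith⟩
    have h2 : |z.im| ≤ ρ + 2 := abs_le.2 ⟨by linarith, by linarith⟩
    linarith [Complex.norm_le_abs_re_add_abs_im z]

/-! ### Logarithms and separation of the plane -/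

/-- The function `z - p` has no continuous logarithm on a compact set that contains the boundary of
a bounded neighbourhood of `p`. Otherwise the logarithm extends continuously to this neighbourhood,
and its exponential, continued by `z - p` outside, has a logarithm on the whole plane, which is
impossible on large circles. -/
theorem false_of_exp_eq_sub {W K : Set ℂ} {p : ℂ} (hWb : Bornology.IsBounded W) (hp : p ∈ W)
    (hK : IsCompact K) (hWK : frontier W ⊆ K) {L : ℂ → ℂ} (hL : ContinuousOn L K)
    (hLp : ∀ z ∈ K, Complex.exp (L z) = z - p) : False := by
  classical
  obtain ⟨L', hL'⟩ := ContinuousMap.exists_restrict_eq hK.isClosed ⟨K.domRestrict L, hL.domRestrict⟩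
  have hLL : ∀ z ∈ K, L' z = L z := fun z hz => congrArg (fun f : C(K, ℂ) => f ⟨z, hz⟩) hL'
  set G : ℂ → ℂ := W.piecewise (fun z => Complex.exp (L' z)) (fun z => z - p) with hG
  have hGc : Continuous G := by
    refine Continuous.piecewise (fun z hz => ?_) (by fun_prop) (by fun_prop)
    rw [hLL z (hWK hz), hLp z (hWK hz)]
  have hGW : ∀ z ∉ W, G z = z - p := fun z hz => piecewise_eq_of_notMem _ _ _ hz
  have hG0 : ∀ z, G z ≠ 0 := by
    intro z
    by_cases hz : z ∈ W
    · rw [hG, piecewise_eq_of_mem _ _ _ hz]; exact Complex.exp_ne_zero _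
    · rw [hGW z hz, sub_ne_zero]; rintro rfl; exact hz hp
  obtain ⟨l, hl, hlG, -⟩ := exists_lift_of_convex Complex.isCoveringMap_exp convex_univ
    (g := fun z => (⟨G z, hG0 z⟩ : {z : ℂ // z ≠ 0}))
    (Continuous.subtype_mk hGc _).continuousOn (mem_univ 0) (y := Complex.log (G 0))
    (Subtype.ext (Complex.exp_log (hG0 0)))
  rw [continuousOn_univ] at hl
  have hlG' : ∀ z, Complex.exp (l z) = G z := fun z => congrArg Subtype.val (hlG z (mem_univ z))
  obtain ⟨r, hr⟩ := hWb.subset_ball p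
  have hr0 : 0 < r := by simpa using hr hp
  have hcirc : ∀ θ : ℝ, p + r * Complex.exp (θ * Complex.I) ∉ W := by
    intro θ h
    have := hr h
    simp [Complex.norm_exp_ofReal_mul_I, abs_of_pos hr0] at this
  have hconst := Complex.isCoveringMap_exp.const_of_comp (A := ℝ)
    (g := fun θ : ℝ => l (p + r * Complex.exp (θ * Complex.I)) - θ * Complex.I) (by fun_prop)
    (fun θ θ' => Subtype.ext (by
      simp only [Complex.exp_sub, hlG', hGW _ (hcirc _), add_sub_cancel_left]
      rw [mul_div_cancel_right₀ _ (Complex.exp_ne_zero _),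
        mul_div_cancel_right₀ _ (Complex.exp_ne_zero _)]))
    0 (2 * Real.pi)
  simp only [Complex.ofReal_zero, zero_mul, Complex.exp_zero, mul_one, sub_zero, Complex.ofReal_mul,
    Complex.ofReal_ofNat, Complex.exp_two_pi_mul_I] at hconst
  exact Complex.two_pi_I_ne_zero (sub_eq_self.1 hconst.symm)

/-! ### Criteria for points to lie in the Fatou set -/

@[simp] lemma chordal_self (z : Sphere) : chordal z z = 0 := by
  induction z using OnePoint.rec with
  | infty => rfl
  | coe z => change 2 * ‖z - z‖ / _ = 0; simp

/-- The point with coordinate `w` in the chart `mob a` is moved by `f` to the point with coordinate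
`chartMap f a w`. -/
noncomputable def chartMap (f : Sphere → Sphere) (a w : ℂ) : ℂ := toC (mob a (f ((mob a).symm w)))

lemma mob_symm_toC {a : ℂ} {z : Sphere} (hz : mob a z ≠ OnePoint.infty) :
    (mob a).symm (toC (mob a z) : Sphere) = z := by
  rw [coe_toC hz, Homeomorph.symm_apply_apply]

/-- If the iterates of `f` are bounded in some chart, and their oscillation on the open set `U`
tends to zero, then `U` is contained in the Fatou set. -/
lemma subset_fatouSet {f : Sphere → Sphere} {a : ℂ} {M : ℝ} {U : Set Sphere} (hU : IsOpen U)
    (hfin : ∀ᶠ n in atTop, ∀ x ∈ U, mob a (f^[n] x) ≠ OnePoint.infty)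
    (hb : ∀ᶠ n in atTop, ∀ x ∈ U, ‖toC (mob a (f^[n] x))‖ ≤ M)
    (hosc : ∀ ε > 0, ∀ᶠ n in atTop, ∀ x ∈ U, ∀ y ∈ U,
      ‖toC (mob a (f^[n] x)) - toC (mob a (f^[n] y))‖ < ε) :
    U ⊆ fatouSet f := by
  intro z hz
  refine ⟨U, hU, hz, fun s => ?_⟩
  obtain ⟨g, hg | hg⟩ := exists_increasing_or_nonincreasing_subseq (· < ·) s
  · have hmono : StrictMono fun k => s (g k) := fun m n hmn => hg m n hmn
    obtain ⟨c, -, ψ, hψ, hlim⟩ := (isCompact_closedBall (0 : ℂ) M).tendsto_subseq'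
      (x := fun k => toC (mob a (f^[s (g k)] z)))
      ((hmono.tendsto_atTop.eventually hb).frequently.mono fun k hk => by simpa using hk z hz)
    have hφ := hmono.comp hψ
    refine ⟨fun k => g (ψ k), g.strictMono.comp hψ, fun _ => (mob a).symm c, fun K _ hKU ε hε => ?_⟩
    have hcont : Tendsto (fun w : ℂ => chordal ((mob a).symm w) ((mob a).symm c)) (𝓝 c) (𝓝 0) :=
      (tendsto_chordal _).comp (((mob a).symm.continuous.comp
        OnePoint.continuous_coe).tendsto c)
    obtain ⟨δ, hδ, hball⟩ := Metric.eventually_nhds_iff.1 (hcont.eventually_lt_const hε)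
    filter_upwards [hφ.tendsto_atTop.eventually hfin,
      hφ.tendsto_atTop.eventually (hosc (δ / 2) (half_pos hδ)),
      Metric.tendsto_nhds.1 hlim (δ / 2) (half_pos hδ)] with k h1 h2 h3 x hx
    have h4 := @hball (toC (mob a (f^[s (g (ψ k))] x))) (by
      rw [Function.comp_apply, dist_eq_norm] at h3
      have := h2 x (hKU hx) z hz
      simp only [Function.comp_apply] at this
      rw [dist_eq_norm]
      linarith [norm_sub_le_norm_sub_add_norm_sub (toC (mob a (f^[s (g (ψ k))] x)))
        (toC (mob a (f^[s (g (ψ k))] z))) c])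
    rwa [mob_symm_toC (z := f^[s (g (ψ k))] x) (h1 x (hKU hx))] at h4
  · obtain ⟨n₀, hn₀⟩ : ∃ n₀, ∀ n, s (g n₀) ≤ s (g n) :=
      ⟨Function.argmin (fun n => s (g n)), fun n => Function.argmin_le (fun n => s (g n)) n⟩
    refine ⟨fun k => g (n₀ + k), fun i j hij => g.strictMono (by omega), f^[s (g n₀)],
      fun K _ _ ε hε => Eventually.of_forall fun k x _ => ?_⟩
    have : s (g (n₀ + k)) = s (g n₀) := by
      rcases Nat.eq_zero_or_pos k with rfl | hk
      · rfl
      · exact le_antisymm (not_lt.1 (hg n₀ (n₀ + k) (by omega))) (hn₀ _)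
    simpa [this] using hε

lemma IsFatouComponent.mem_of_mem_closure {f : Sphere → Sphere} {A : Set Sphere}
    (hA : IsFatouComponent f A) {x : Sphere} (hx : x ∈ closure A) (hxF : x ∈ fatouSet f) :
    x ∈ A := by
  obtain ⟨z, hz, rfl⟩ := hA
  have hpre : IsPreconnected (insert x (connectedComponentIn (fatouSet f) z)) :=
    isPreconnected_connectedComponentIn.subset_closure (subset_insert _ _)
      (insert_subset hx subset_closure)
  exact hpre.subset_connectedComponentIn (Or.inr (mem_connectedComponentIn hz))
    (insert_subset hxF (connectedComponentIn_subset _ _)) (mem_insert _ _)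

/-- The iterates of a rational map are holomorphic in the chart `mob a` as long as the orbit avoids
the point `a`. -/
lemma analyticAt_iterate_chart (R : RatFunc ℂ) (a : ℂ) (n : ℕ) {w : ℂ}
    (h : ∀ m ≤ n, mob a ((ratMap R)^[m] ((mob a).symm w)) ≠ OnePoint.infty) :
    AnalyticAt ℂ (chartMap (ratMap R)^[n] a) w := by
  induction n with
  | zero =>
    refine analyticAt_id.congr (Eventually.of_forall fun v => ?_)
    simp [chartMap]
  | succ n ih =>
    have hrec : ∀ v : ℂ, mob a ((ratMap R)^[n] ((mob a).symm v)) ≠ OnePoint.infty →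
        mob a ((ratMap R)^[n + 1] ((mob a).symm v)) =
          mob a (ratMap R ((mob a).symm (chartMap (ratMap R)^[n] a v))) := by
      intro v hv
      rw [Function.iterate_succ_apply', chartMap, mob_symm_toC hv]
    have hn := h n n.le_succ
    have h1 := analyticAt_ratMap_chart R a a (chartMap (ratMap R)^[n] a w)
      (by rw [← hrec w hn]; exact h _ le_rfl)
    refine (h1.comp (ih fun m hm => h m (hm.trans n.le_succ))).congr ?_
    have hcont : Continuous fun v : ℂ => mob a ((ratMap R)^[n] ((mob a).symm v)) :=
      (mob a).continuous.comp (((continuous_ratMap R).iterate n).comp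
        ((mob a).symm.continuous.comp OnePoint.continuous_coe))
    filter_upwards [hcont.continuousAt.eventually_ne hn] with v hv
    simp only [Function.comp_apply]
    rw [← hrec v hv]
    rfl

/-- Near points that are bounded together with their image, a rational map is finite in the chart
`mob a`, uniformly. -/
lemma exists_pos_forall_ne_infty (R : RatFunc ℂ) (a : ℂ) (M : ℝ) :
    ∃ δ > 0, ∀ x y : ℂ, ‖x‖ ≤ M → mob a (ratMap R ((mob a).symm x)) ≠ OnePoint.infty →
      ‖chartMap (ratMap R) a x‖ ≤ M → ‖y - x‖ < δ →
      mob a (ratMap R ((mob a).symm y)) ≠ OnePoint.infty := by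
  have hS : Continuous fun x : ℂ => mob a (ratMap R ((mob a).symm x)) :=
    (mob a).continuous.comp ((continuous_ratMap R).comp ((mob a).symm.continuous.comp
      OnePoint.continuous_coe))
  set B : Set Sphere := ((↑) : ℂ → Sphere) '' Metric.closedBall 0 M with hB
  have hBc : IsClosed B := ((isCompact_closedBall _ _).image OnePoint.continuous_coe).isClosed
  have hT : IsCompact (Metric.closedBall (0 : ℂ) M ∩
      (fun x : ℂ => mob a (ratMap R ((mob a).symm x))) ⁻¹' B) :=
    (isCompact_closedBall _ _).inter_right (hBc.preimage hS)
  obtain ⟨δ, hδ, hthick⟩ := hT.exists_thickening_subset_open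
    ((isClosed_singleton (x := (OnePoint.infty : Sphere))).isOpen_compl.preimage hS)
    (by
      rintro x ⟨-, w, -, hw⟩ h
      rw [mem_singleton_iff, ← hw] at h
      exact OnePoint.coe_ne_infty w h)
  refine ⟨δ, hδ, fun x y hx hfin hxM hxy => hthick (Metric.mem_thickening_iff.2 ⟨x, ⟨?_, ?_⟩, ?_⟩)⟩
  · simpa using hx
  · exact ⟨chartMap (ratMap R) a x, by simpa using hxM, coe_toC hfin⟩
  · rwa [dist_eq_norm]

/-- If the images of the boundary of `W` under the iterates of a rational map remain bounded and
stay small in the chart `mob a`, then so do the images of `W`, by the maximum principle. -/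
lemma norm_sub_le_of_frontier {R : RatFunc ℂ} {a : ℂ} {M δ : ℝ}
    (hδ : ∀ x y : ℂ, ‖x‖ ≤ M → mob a (ratMap R ((mob a).symm x)) ≠ OnePoint.infty →
      ‖chartMap (ratMap R) a x‖ ≤ M → ‖y - x‖ < δ →
      mob a (ratMap R ((mob a).symm y)) ≠ OnePoint.infty)
    {W : Set ℂ} (hWb : Bornology.IsBounded W) {w₀ : ℂ}
    (hfin : ∀ n, mob a ((ratMap R)^[n] ((mob a).symm w₀)) ≠ OnePoint.infty)
    (hM : ∀ n, ‖chartMap (ratMap R)^[n] a w₀‖ ≤ M)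
    (hsmall : ∀ n, ∃ ε < δ, ∀ w ∈ frontier W,
      ‖chartMap (ratMap R)^[n] a w - chartMap (ratMap R)^[n] a w₀‖ ≤ ε) (n : ℕ) :
    (∀ w ∈ closure W, mob a ((ratMap R)^[n] ((mob a).symm w)) ≠ OnePoint.infty) ∧
      ∀ ε, (∀ w ∈ frontier W,
          ‖chartMap (ratMap R)^[n] a w - chartMap (ratMap R)^[n] a w₀‖ ≤ ε) →
        ∀ w ∈ closure W,
          ‖chartMap (ratMap R)^[n] a w - chartMap (ratMap R)^[n] a w₀‖ ≤ ε := by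
  induction n using Nat.strong_induction_on with
  | _ n ih =>
    have hfinW : ∀ w ∈ closure W, mob a ((ratMap R)^[n] ((mob a).symm w)) ≠ OnePoint.infty := by
      intro w hw
      rcases n with _ | n
      · simp
      · have hrec : ∀ v : ℂ, mob a ((ratMap R)^[n] ((mob a).symm v)) ≠ OnePoint.infty →
            mob a ((ratMap R)^[n + 1] ((mob a).symm v)) =
              mob a (ratMap R ((mob a).symm (chartMap (ratMap R)^[n] a v))) := by
          intro v hv
          rw [Function.iterate_succ_apply', chartMap, mob_symm_toC hv]
        obtain ⟨h1, h2⟩ := ih n n.lt_succ_self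
        obtain ⟨ε, hε, hle⟩ := hsmall n
        rw [hrec w (h1 w hw)]
        refine hδ (chartMap (ratMap R)^[n] a w₀) _ (hM n) ?_ ?_ ((h2 ε hle w hw).trans_lt hε)
        · rw [← hrec w₀ (hfin n)]; exact hfin (n + 1)
        · have := hM (n + 1)
          rwa [chartMap, hrec w₀ (hfin n)] at this
    refine ⟨hfinW, fun ε hle w hw => ?_⟩
    have hdiff : DifferentiableOn ℂ (fun w => chartMap (ratMap R)^[n] a w -
        chartMap (ratMap R)^[n] a w₀) (closure W) := fun v hv =>
      ((analyticAt_iterate_chart R a n fun m hm => by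
        rcases hm.eq_or_lt with rfl | hm
        · exact hfinW v hv
        · exact (ih m hm).1 v hv).differentiableAt.sub_const _).differentiableWithinAt
    exact Complex.norm_le_of_forall_mem_frontier_norm_le hWb hdiff.diffContOnCl hle hw

/-! ### Wandering components -/

section Wandering

variable {R : RatFunc ℂ} {A : ℕ → Set Sphere} {a : ℂ} {r : ℝ}

lemma iterate_image_eq {X : Type*} {f : X → X} {A : ℕ → Set X} (hA : ∀ n, A (n + 1) = f '' A n)
    (m n : ℕ) : A (m + n) = f^[n] '' A m := by
  induction n with
  | zero => simp
  | succ n ih => rw [← add_assoc, hA, ih, image_image, Function.iterate_succ']; rfl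

lemma iterate_mem {X : Type*} {f : X → X} {A : ℕ → Set X} (hA : ∀ n, A (n + 1) = f '' A n)
    {m : ℕ} {z : X} (hz : z ∈ A m) (n : ℕ) : f^[n] z ∈ A (m + n) := by
  rw [iterate_image_eq hA]; exact mem_image_of_mem _ hz

lemma isOpen_orbit (hR : 1 ≤ ratDegree R) (hA : ∀ n, A (n + 1) = ratMap R '' A n)
    (hA₀ : IsOpen (A 0)) (n : ℕ) : IsOpen (A n) := by
  induction n with
  | zero => exact hA₀
  | succ n ih => rw [hA]; exact isOpenMap_ratMap hR _ ih

/-- In a chart that sends a point of `A 0` to `∞`, the sets `A n` with `n ≥ 1` are uniformly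
bounded. -/
lemma bounded_orbit (hr : 0 < r) (hball : ((↑) : ℂ → Sphere) '' Metric.ball a r ⊆ A 0)
    (hdisj : ∀ m n : ℕ, m ≠ n → Disjoint (A m) (A n)) {n : ℕ} (hn : 1 ≤ n) {z : Sphere}
    (hz : z ∈ A n) : mob a z ≠ OnePoint.infty ∧ ‖toC (mob a z)‖ ≤ r⁻¹ := by
  have h0 : z ∉ ((↑) : ℂ → Sphere) '' Metric.ball a r := fun h =>
    disjoint_left.1 (hdisj 0 n (by omega)) (hball h) hz
  refine ⟨fun h => h0 ?_, norm_toC_mob_le hr h0⟩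
  rw [mob_eq_infty] at h
  exact ⟨a, Metric.mem_ball_self hr, h.symm⟩

/-- The iterates of a rational map shrink the compact subsets of a wandering domain to points. -/
lemma eventually_oscillation_lt (hR : 1 ≤ ratDegree R) (hA : ∀ n, A (n + 1) = ratMap R '' A n)
    (hA₀ : IsOpen (A 0)) (hA₀c : IsPreconnected (A 0)) (hr : 0 < r)
    (hball : ((↑) : ℂ → Sphere) '' Metric.ball a r ⊆ A 0)
    (hdisj : ∀ m n : ℕ, m ≠ n → Disjoint (A m) (A n)) {K : Set Sphere} (hK : IsCompact K)
    (hKA : K ⊆ A 0) {ε : ℝ} (hε : 0 < ε) :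
    ∀ᶠ n in atTop, ∀ x ∈ K, ∀ y ∈ K,
      ‖toC (mob a ((ratMap R)^[n] x)) - toC (mob a ((ratMap R)^[n] y))‖ < ε := by
  set f := ratMap R with hf
  set U : Set ℂ := {w | (mob a).symm w ∈ A 1} with hU
  have hcont : Continuous fun w : ℂ => (mob a).symm w :=
    (mob a).symm.continuous.comp OnePoint.continuous_coe
  have hbd := fun (n : ℕ) (hn : 1 ≤ n) (z : Sphere) (hz : z ∈ A n) =>
    bounded_orbit hr hball hdisj hn hz
  have hUimg : U = (fun z => toC (mob a z)) '' A 1 := by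
    ext w
    constructor
    · intro hw
      exact ⟨_, hw, by simp⟩
    · rintro ⟨z, hz, rfl⟩
      change (mob a).symm _ ∈ A 1
      rwa [mob_symm_toC (hbd 1 le_rfl z hz).1]
  have hcA : ContinuousOn (fun z => toC (mob a z)) (A 1) := fun z hz =>
    (ContinuousAt.comp (g := toC) (continuousAt_toC (hbd 1 le_rfl z hz).1)
      (mob a).continuous.continuousAt).continuousWithinAt
  have hUo : IsOpen U := (isOpen_orbit hR hA hA₀ 1).preimage hcont
  have hUc : IsPreconnected U := by
    rw [hUimg]
    refine IsPreconnected.image ?_ _ hcA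
    rw [hA]
    exact hA₀c.image _ (continuous_ratMap R).continuousOn
  have hmem : ∀ n, ∀ w ∈ U, f^[n] ((mob a).symm w) ∈ A (n + 1) := fun n w hw => by
    rw [add_comm]; exact iterate_mem hA hw n
  have hmain := eventually_norm_sub_lt (U := U) (F := fun n => chartMap f^[n] a) (M := r⁻¹)
    (inv_pos.2 hr) hUo hUc
    (fun n w hw => (analyticAt_iterate_chart R a n fun m _ =>
      (hbd _ (by omega) _ (hmem m w hw)).1).differentiableAt.differentiableWithinAt)
    (fun n w hw => (hbd _ (by omega) _ (hmem n w hw)).2)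
    (fun m n hmn => by
      refine disjoint_left.2 ?_
      rintro _ ⟨v, hv, rfl⟩ ⟨w, hw, hvw⟩
      refine disjoint_left.1 (hdisj (m + 1) (n + 1) (by omega)) (hmem m v hv) ?_
      have h1 := congrArg (fun x : ℂ => (mob a).symm (x : Sphere)) hvw
      simp only [chartMap] at h1
      rw [mob_symm_toC (hbd _ (by omega) _ (hmem m v hv)).1,
        mob_symm_toC (hbd _ (by omega) _ (hmem n w hw)).1] at h1
      rw [← h1]
      exact hmem n w hw)
    (K := (fun z => toC (mob a z)) '' (f '' K))
    ((hK.image (continuous_ratMap R)).image_of_continuousOn (hcA.mono (by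
      rw [hA]; exact image_mono hKA)))
    (by rw [hUimg, hA]; exact image_mono (image_mono hKA)) hε
  obtain ⟨N, hN⟩ := eventually_atTop.1 hmain
  refine eventually_atTop.2 ⟨N + 1, fun n hn x hx y hy => ?_⟩
  obtain ⟨m, rfl⟩ : ∃ m, n = m + 1 := ⟨n - 1, by omega⟩
  have h1 := hN m (by omega) _ (mem_image_of_mem _ (mem_image_of_mem _ hx)) _
    (mem_image_of_mem _ (mem_image_of_mem _ hy))
  have h2 : ∀ z ∈ K, chartMap f^[m] a (toC (mob a (f z))) = toC (mob a (f^[m + 1] z)) := by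
    intro z hz
    have hz1 : f z ∈ A 1 := by rw [hA]; exact mem_image_of_mem _ (hKA hz)
    rw [chartMap, mob_symm_toC (hbd 1 le_rfl _ hz1).1, Function.iterate_succ_apply]
  simpa only [h2 x hx, h2 y hy] using h1

/-- A wandering Fatou component has no holes inside small curves: if the boundary of a bounded
domain `W` of the plane (in the chart `mob a`) lies in the image of a compact subset of `A 0` under
the `N`-th iterate, and this and all later images are small, then `W` is contained in `A N`. -/
lemma subset_of_frontier_subset (hR : 1 ≤ ratDegree R)
    (hcomp : IsFatouComponent (ratMap R) (A 0)) (hA : ∀ n, A (n + 1) = ratMap R '' A n)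
    (hA₀ : IsOpen (A 0)) (hA₀c : IsPreconnected (A 0)) (hr : 0 < r)
    (hball : ((↑) : ℂ → Sphere) '' Metric.ball a r ⊆ A 0)
    (hdisj : ∀ m n : ℕ, m ≠ n → Disjoint (A m) (A n)) {δ : ℝ} (hδ0 : 0 < δ)
    (hδ : ∀ x y : ℂ, ‖x‖ ≤ r⁻¹ → mob a (ratMap R ((mob a).symm x)) ≠ OnePoint.infty →
      ‖chartMap (ratMap R) a x‖ ≤ r⁻¹ → ‖y - x‖ < δ →
      mob a (ratMap R ((mob a).symm y)) ≠ OnePoint.infty)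
    {K : Set Sphere} (hK : IsCompact K) (hKA : K ⊆ A 0) {N : ℕ} (hN : 1 ≤ N)
    (hsmall : ∀ n, N ≤ n → ∀ x ∈ K, ∀ y ∈ K,
      ‖toC (mob a ((ratMap R)^[n] x)) - toC (mob a ((ratMap R)^[n] y))‖ < δ / 2)
    {W : Set ℂ} (hWo : IsOpen W) (hWc : IsPreconnected W) (hWb : Bornology.IsBounded W)
    (hWK : frontier W ⊆ (fun z => toC (mob a ((ratMap R)^[N] z))) '' K) :
    ∀ w ∈ W, (mob a).symm (w : Sphere) ∈ A N := by
  set f := ratMap R with hf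
  have hcont : Continuous fun w : ℂ => (mob a).symm w :=
    (mob a).symm.continuous.comp OnePoint.continuous_coe
  intro p hp
  obtain ⟨w₀, hw₀⟩ : (frontier W).Nonempty := by
    rw [nonempty_frontier_iff]
    refine ⟨⟨p, hp⟩, ?_⟩
    rintro rfl
    exact NormedSpace.unbounded_univ ℂ ℂ hWb
  have hKN : ∀ n, ∀ x ∈ K, f^[n] x ∈ A n := fun n x hx => by
    simpa using iterate_mem hA (hKA hx) n
  have hfr : ∀ w ∈ frontier W, ∃ x ∈ K, ∀ n, f^[n] ((mob a).symm w) = f^[N + n] x := by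
    intro w hw
    obtain ⟨x, hx, rfl⟩ := hWK hw
    refine ⟨x, hx, fun n => ?_⟩
    dsimp only
    rw [mob_symm_toC (bounded_orbit hr hball hdisj hN (hKN N x hx)).1, add_comm N,
      Function.iterate_add_apply]
  have hfrb : ∀ w ∈ frontier W, ∀ n, mob a (f^[n] ((mob a).symm w)) ≠ OnePoint.infty ∧
      ‖chartMap f^[n] a w‖ ≤ r⁻¹ := by
    intro w hw n
    obtain ⟨x, hx, hxn⟩ := hfr w hw
    rw [chartMap, hxn]
    exact bounded_orbit hr hball hdisj (by omega) (hKN (N + n) x hx)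
  have hfrd : ∀ n ε, (∀ x ∈ K, ∀ y ∈ K,
      ‖toC (mob a (f^[N + n] x)) - toC (mob a (f^[N + n] y))‖ < ε) → ∀ w ∈ frontier W,
        ‖chartMap f^[n] a w - chartMap f^[n] a w₀‖ ≤ ε := by
    intro n ε h w hw
    obtain ⟨x, hx, hxn⟩ := hfr w hw
    obtain ⟨y, hy, hyn⟩ := hfr w₀ hw₀
    rw [chartMap, chartMap, hxn, hyn]
    exact (h x hx y hy).le
  have hmax := norm_sub_le_of_frontier hδ hWb (fun n => (hfrb w₀ hw₀ n).1)
    (fun n => (hfrb w₀ hw₀ n).2)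
    (fun n => ⟨δ / 2, by linarith, hfrd n _ (hsmall (N + n) (by omega))⟩)
  -- the `N`-th preimage of `W` is contained in the Fatou set
  set V : Set Sphere := f^[N] ⁻¹' (mob a ⁻¹' (((↑) : ℂ → Sphere) '' W)) with hV
  have hVo : IsOpen V := ((OnePoint.isOpenMap_coe W hWo).preimage (mob a).continuous).preimage
    ((continuous_ratMap R).iterate N)
  have hVW : ∀ x ∈ V, ∀ n, N ≤ n → ∃ w ∈ W,
      mob a (f^[n] x) = mob a (f^[n - N] ((mob a).symm w)) := by
    rintro x ⟨w, hw, hwx⟩ n hn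
    refine ⟨w, hw, ?_⟩
    rw [hwx, Homeomorph.symm_apply_apply, ← Function.iterate_add_apply, Nat.sub_add_cancel hn]
  have hVF : V ⊆ fatouSet f := by
    refine subset_fatouSet (a := a) (M := r⁻¹ + δ / 2) hVo ?_ ?_ ?_
    · filter_upwards [eventually_ge_atTop N] with n hn x hx
      obtain ⟨w, hw, hwx⟩ := hVW x hx n hn
      rw [hwx]
      exact (hmax (n - N)).1 w (subset_closure hw)
    · filter_upwards [eventually_ge_atTop N] with n hn x hx
      obtain ⟨w, hw, hwx⟩ := hVW x hx n hn
      rw [hwx]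
      have h1 := (hmax (n - N)).2 _ (hfrd (n - N) _ (hsmall _ (by omega))) w (subset_closure hw)
      have h2 := (hfrb w₀ hw₀ (n - N)).2
      have h3 := norm_sub_norm_le (chartMap f^[n - N] a w) (chartMap f^[n - N] a w₀)
      change ‖chartMap f^[n - N] a w‖ ≤ _
      linarith
    · intro ε hε
      filter_upwards [eventually_ge_atTop N,
        eventually_oscillation_lt hR hA hA₀ hA₀c hr hball hdisj hK hKA
          (show 0 < ε / 3 by positivity)] with n hn hosc x hx y hy
      obtain ⟨v, hv, hvx⟩ := hVW x hx n hn
      obtain ⟨w, hw, hwy⟩ := hVW y hy n hn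
      have hfr' := hfrd (n - N) (ε / 3) (by rwa [Nat.add_sub_cancel' hn])
      have h1 := (hmax (n - N)).2 _ hfr' v (subset_closure hv)
      have h2 := (hmax (n - N)).2 _ hfr' w (subset_closure hw)
      rw [hvx, hwy]
      change ‖chartMap f^[n - N] a v - chartMap f^[n - N] a w‖ < ε
      rw [norm_sub_rev] at h2
      linarith [norm_sub_le_norm_sub_add_norm_sub (chartMap f^[n - N] a v)
        (chartMap f^[n - N] a w₀) (chartMap f^[n - N] a w)]
  -- if `W` leaves `A N`, then it meets the image of the boundary of `A 0`
  by_contra hpN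
  set U : Set ℂ := {w | (mob a).symm w ∈ A N} with hU
  have hUo : IsOpen U := (isOpen_orbit hR hA hA₀ N).preimage hcont
  have hw₀U : w₀ ∈ U := by
    obtain ⟨x, hx, hxn⟩ := hfr w₀ hw₀
    have := hxn 0
    simp only [Function.iterate_zero, id_eq, add_zero] at this
    change (mob a).symm w₀ ∈ A N
    rw [this]
    exact hKN N x hx
  have hWU : (W ∩ U).Nonempty := by
    have := mem_closure_iff.1 (frontier_subset_closure hw₀) U hUo hw₀U
    rwa [inter_comm]
  obtain ⟨y, hyW, hyU⟩ : (W ∩ frontier U).Nonempty := by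
    by_contra hne
    rw [not_nonempty_iff_eq_empty] at hne
    have h1 : W ⊆ interior U ∪ (closure U)ᶜ := by
      intro w hw
      by_contra hcon
      rw [mem_union, not_or, mem_compl_iff, not_not] at hcon
      exact (hne ▸ (⟨hw, hcon.2, hcon.1⟩ : w ∈ W ∩ frontier U) : w ∈ (∅ : Set ℂ))
    obtain ⟨u, hu⟩ := hWU
    obtain ⟨v, -, hv1, hv2⟩ := hWc _ _ isOpen_interior isClosed_closure.isOpen_compl h1
      ⟨u, hu.1, by rw [hUo.interior_eq]; exact hu.2⟩
      ⟨p, hp, fun h => by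
        have : p ∈ W ∩ frontier U := ⟨hp, h, fun h' => hpN (show p ∈ U from interior_subset h')⟩
        rw [hne] at this
        exact this⟩
    exact hv2 (subset_closure (interior_subset hv1))
  have hyA : (mob a).symm (y : Sphere) ∈ closure (A N) := by
    have h1 : (mob a).symm (y : Sphere) ∈ (fun w : ℂ => (mob a).symm (w : Sphere)) '' closure U :=
      ⟨y, frontier_subset_closure hyU, rfl⟩
    refine closure_mono ?_ (image_closure_subset_closure_image hcont h1)
    rintro _ ⟨w, hw, rfl⟩
    exact hw
  have hclos : closure (A N) ⊆ f^[N] '' closure (A 0) := by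
    refine closure_minimal ?_
      (isClosed_closure.isCompact.image ((continuous_ratMap R).iterate N)).isClosed
    have := iterate_image_eq hA 0 N
    rw [zero_add] at this
    rw [this]
    exact image_mono subset_closure
  obtain ⟨x, hx, hxy⟩ := hclos hyA
  have hxV : x ∈ V := ⟨y, hyW, by rw [hxy, Homeomorph.apply_symm_apply]⟩
  have hxA := hcomp.mem_of_mem_closure hx (hVF hxV)
  have : y ∈ interior U := by
    rw [hUo.interior_eq]
    change (mob a).symm y ∈ A N
    rw [← hxy]
    simpa using iterate_mem hA hxA N
  exact hyU.2 this

end Wandering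

/-! ### Lifting through the orbit -/

section Lifting

lemma exists_codRestrict {X T : Type*} [TopologicalSpace X] [TopologicalSpace T] {G : Set X}
    {B : Set T} {s : X → T} (hs : ContinuousOn s G) (hsB : MapsTo s G B) (b : B) :
    ∃ g : X → B, ContinuousOn g G ∧ ∀ w ∈ G, (g w : T) = s w := by
  classical
  have hval : ∀ w ∈ G, ((if h : s w ∈ B then ⟨s w, h⟩ else b : B) : T) = s w := fun w hw => by
    rw [dif_pos (hsB hw)]
  refine ⟨fun w => if h : s w ∈ B then ⟨s w, h⟩ else b, ?_, hval⟩
  rw [IsInducing.subtypeVal.continuousOn_iff]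
  exact hs.congr hval

/-- Suppose that the composition of a map `u : K → E` with a covering map factors through a map `g`
on a grid region. Then `u` factors through a lift of `g`. -/
lemma exists_lift_of_factor {E B X : Type*} [TopologicalSpace E] [TopologicalSpace B]
    [TopologicalSpace X] {π : E → B} (hπ : IsCoveringMap π) {F : Type*}
    (hF : ∀ z, Nonempty (F ≃ π ⁻¹' {z})) {c : ℂ} {η : ℝ} (hη : 0 < η) {Q : Set (ℕ × ℕ)} {n : ℕ}
    (hQ : ∀ s : ℕ × ℕ, n ≤ s.1 ∨ n ≤ s.2 → s ∈ Q) {g : ℂ → B}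
    (hg : ContinuousOn g (gridRegion c η Q n)) {K : Set X} (hK : IsConnected K) {k : X → ℂ}
    (hk : ContinuousOn k K) (hkG : MapsTo k K (gridRegion c η Q n)) {u : X → E}
    (hu : ContinuousOn u K) (hguk : ∀ x ∈ K, g (k x) = π (u x)) :
    ∃ l : ℂ → E, ContinuousOn l (gridRegion c η Q n) ∧
      (∀ w ∈ gridRegion c η Q n, π (l w) = g w) ∧ ∀ x ∈ K, l (k x) = u x := by
  obtain ⟨x₀, hx₀⟩ := hK.nonempty
  obtain ⟨l, hl, hlg, hl0⟩ := exists_lift_gridRegion hπ hF hη hQ hg (hkG hx₀) (y := u x₀)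
    (hguk x₀ hx₀).symm
  refine ⟨l, hl, hlg, ?_⟩
  exact hπ.eqOn_of_comp_eqOn hK.isPreconnected (g₁ := l ∘ k) (hl.comp hk hkG) hu
    (fun x hx => (hlg _ (hkG hx)).trans (hguk x hx)) hx₀ hl0

/-- The sphere-valued form of `exists_lift_of_factor`, for a map that restricts to a covering. -/
lemma IsCoveringOfDegree.exists_lift {f : Sphere → Sphere} {A B : Set Sphere} {d : ℕ}
    (hcov : IsCoveringOfDegree f A B d) {c : ℂ} {η : ℝ} (hη : 0 < η) {Q : Set (ℕ × ℕ)} {n : ℕ}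
    (hQ : ∀ s : ℕ × ℕ, n ≤ s.1 ∨ n ≤ s.2 → s ∈ Q) {s : ℂ → Sphere}
    (hs : ContinuousOn s (gridRegion c η Q n)) (hsB : MapsTo s (gridRegion c η Q n) B)
    {K : Set Sphere} (hK : IsConnected K) {k : Sphere → ℂ} (hk : ContinuousOn k K)
    (hkG : MapsTo k K (gridRegion c η Q n)) {u : Sphere → Sphere} (hu : ContinuousOn u K)
    (huA : MapsTo u K A) (hsku : ∀ x ∈ K, s (k x) = f (u x)) :
    ∃ s' : ℂ → Sphere, ContinuousOn s' (gridRegion c η Q n) ∧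
      MapsTo s' (gridRegion c η Q n) A ∧ ∀ x ∈ K, s' (k x) = u x := by
  obtain ⟨x₀, hx₀⟩ := hK.nonempty
  obtain ⟨hmaps, hπ, hd⟩ := hcov
  have hF : ∀ z : B, Nonempty (Fin d ≃ hmaps.restrict f A B ⁻¹' {z}) := by
    intro z
    have h1 : ENat.card {x ∈ A | f x = z} = d := hd z z.2
    have h2 : {x ∈ A | f x = z}.Finite := finite_of_encard_eq_coe h1
    have h3 : Nat.card {x ∈ A | f x = z} = d := by
      rw [Nat.card_coe_set_eq, Set.ncard, hd z z.2]; rfl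
    have := h2.to_subtype
    refine ⟨(Finite.equivFinOfCardEq h3).symm.trans ⟨fun x => ⟨⟨x, x.2.1⟩, Subtype.ext x.2.2⟩,
      fun y => ⟨y.1.1, y.1.2, congrArg Subtype.val y.2⟩, fun x => rfl, fun y => rfl⟩⟩
  obtain ⟨g, hg, hgs⟩ := exists_codRestrict hs hsB ⟨_, hsB (hkG hx₀)⟩
  obtain ⟨v, hv, hvu⟩ := exists_codRestrict hu huA ⟨_, huA hx₀⟩
  obtain ⟨l, hl, -, hlk⟩ := exists_lift_of_factor hπ hF hη hQ hg hK hk hkG hv fun x hx =>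
    Subtype.ext (by
      rw [hgs _ (hkG hx), hsku x hx, ← hvu x hx]; rfl)
  refine ⟨fun w => l w, continuous_subtype_val.comp_continuousOn hl, fun w _ => (l w).2,
    fun x hx => ?_⟩
  simp only [hlk x hx, hvu x hx]

/-- A map on a grid region that inverts an iterate of `f` on the image of a connected set `K`: it is
obtained by lifting the inclusion of the grid region step by step through the coverings. -/
lemma exists_lift_iterate {f : Sphere → Sphere} (hf : Continuous f) {A : ℕ → Set Sphere}
    (hA : ∀ n, A (n + 1) = f '' A n) {d : ℕ → ℕ}
    (hcov : ∀ n, IsCoveringOfDegree f (A n) (A (n + 1)) (d n)) {c : ℂ} {η : ℝ} (hη : 0 < η)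
    {Q : Set (ℕ × ℕ)} {n : ℕ} (hQ : ∀ s : ℕ × ℕ, n ≤ s.1 ∨ n ≤ s.2 → s ∈ Q)
    {K : Set Sphere} (hK : IsConnected K) (hKA : K ⊆ A 0) {k : Sphere → ℂ} (hk : ContinuousOn k K)
    (hkG : MapsTo k K (gridRegion c η Q n)) (N : ℕ) :
    ∀ s : ℂ → Sphere, ContinuousOn s (gridRegion c η Q n) →
      MapsTo s (gridRegion c η Q n) (A N) → (∀ x ∈ K, s (k x) = f^[N] x) →
      ∃ s' : ℂ → Sphere, ContinuousOn s' (gridRegion c η Q n) ∧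
        MapsTo s' (gridRegion c η Q n) (A 0) ∧ ∀ x ∈ K, s' (k x) = x := by
  induction N with
  | zero => exact fun s h1 h2 h3 => ⟨s, h1, h2, h3⟩
  | succ N ih =>
    intro s h1 h2 h3
    obtain ⟨s', k1, k2, k3⟩ := (hcov N).exists_lift hη hQ h1 h2 hK hk hkG
      (u := f^[N]) (hf.iterate N).continuousOn
      (fun x hx => by simpa using iterate_mem hA (hKA hx) N)
      (fun x hx => by rw [h3 x hx, Function.iterate_succ_apply'])
    exact ih s' k1 k2 k3

/-- A continuous function without zeros on a grid region has a logarithm on the image of a connected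
set. -/
lemma exists_log_gridRegion {c : ℂ} {η : ℝ} (hη : 0 < η) {Q : Set (ℕ × ℕ)} {n : ℕ}
    (hQ : ∀ s : ℕ × ℕ, n ≤ s.1 ∨ n ≤ s.2 → s ∈ Q) {g : ℂ → ℂ}
    (hg : ContinuousOn g (gridRegion c η Q n)) (hg0 : ∀ w ∈ gridRegion c η Q n, g w ≠ 0) :
    ∃ l : ℂ → ℂ, ContinuousOn l (gridRegion c η Q n) ∧
      ∀ w ∈ gridRegion c η Q n, Complex.exp (l w) = g w := by
  rcases (gridRegion c η Q n).eq_empty_or_nonempty with he | ⟨w₀, hw₀⟩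
  · rw [he]; exact ⟨0, continuousOn_empty _, by simp⟩
  have hF : ∀ z : {z : ℂ // z ≠ 0}, Nonempty ({x : ℂ // Complex.exp x = 1} ≃
      (fun z : ℂ => (⟨Complex.exp z, z.exp_ne_zero⟩ : {z : ℂ // z ≠ 0})) ⁻¹' {z}) := fun z =>
    ⟨⟨fun x => ⟨x + Complex.log z, Subtype.ext (by
        simp only [Complex.exp_add, x.2, Complex.exp_log z.2, one_mul])⟩,
      fun y => ⟨y - Complex.log z, by
        rw [Complex.exp_sub, Complex.exp_log z.2,
          show Complex.exp y = z from congrArg Subtype.val y.2, div_self z.2]⟩,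
      fun x => by simp, fun y => by simp⟩⟩
  obtain ⟨g', hg', hgg⟩ := exists_codRestrict (B := {z : ℂ | z ≠ 0}) hg hg0 ⟨1, one_ne_zero⟩
  obtain ⟨l, hl, hlg, -⟩ := exists_lift_gridRegion Complex.isCoveringMap_exp hF hη hQ hg' hw₀
    (y := Complex.log (g w₀)) (Subtype.ext (by
      rw [hgg w₀ hw₀]; exact Complex.exp_log (hg0 w₀ hw₀)))
  exact ⟨l, hl, fun w hw => (congrArg Subtype.val (hlg w hw)).trans (hgg w hw)⟩

end Lifting

/-! ### Components of the complement of a compact set -/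

lemma isPreconnected_setOf_lt_norm {ρ : ℝ} (hρ : 0 < ρ) : IsPreconnected {z : ℂ | ρ < ‖z‖} := by
  have : {z : ℂ | ρ < ‖z‖} = Complex.exp '' {z : ℂ | Real.log ρ < z.re} := by
    ext z
    constructor
    · intro hz
      have hz0 : z ≠ 0 := norm_pos_iff.1 (hρ.trans hz)
      exact ⟨Complex.log z, by
        simpa [Complex.log_re] using Real.log_lt_log hρ hz, Complex.exp_log hz0⟩
    · rintro ⟨w, hw, rfl⟩
      change ρ < ‖Complex.exp w‖
      rw [Complex.norm_exp, ← Real.log_lt_iff_lt_exp hρ]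
      exact hw
  rw [this]
  exact (convex_halfSpace_re_gt _).isPreconnected.image _ Complex.continuous_exp.continuousOn

lemma frontier_connectedComponentIn_subset {O : Set ℂ} (hO : IsOpen O) (z : ℂ) :
    frontier (connectedComponentIn O z) ⊆ Oᶜ := by
  intro w hw hwO
  have hopen := hO.connectedComponentIn (x := z)
  have hnhds : connectedComponentIn O w ∈ 𝓝 w :=
    (hO.connectedComponentIn).mem_nhds (mem_connectedComponentIn hwO)
  obtain ⟨v, hv1, hv2⟩ := mem_closure_iff_nhds.1 (frontier_subset_closure hw) _ hnhds
  have h := (connectedComponentIn_eq hv1).trans (connectedComponentIn_eq hv2).symm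
  rw [hopen.frontier_eq, ← h] at hw
  exact hw.2 (mem_connectedComponentIn hwO)

/-! ### Annuli -/

/-- The complement of an annulus is the union of two disjoint nonempty closed sets, of which the
second contains a finite point. -/
lemma IsAnnulus.exists_isClosed {A : Set Sphere} (hA : IsAnnulus A) :
    ∃ (E E' : Set Sphere) (p : Sphere) (q : ℂ), IsClosed E ∧ IsClosed E' ∧ Disjoint E E' ∧
      E ∪ E' = Aᶜ ∧ p ∈ E ∧ (q : Sphere) ∈ E' := by
  have hnot : ¬ IsPreconnected (Aᶜ) := by
    intro h
    have := isPreconnected_iff_preconnectedSpace.1 h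
    have h1 := Finite.card_le_one_iff_subsingleton.2
      (inferInstance : Subsingleton (ConnectedComponents ↥(Aᶜ)))
    rw [hA.2.2] at h1
    omega
  rw [isPreconnected_closed_iff] at hnot
  push Not at hnot
  obtain ⟨t, t', ht, ht', hsub, ⟨x, hx⟩, ⟨y, hy⟩, hempty⟩ := hnot
  have hAc : IsClosed (Aᶜ) := hA.1.isClosed_compl
  have hdisj : Disjoint (Aᶜ ∩ t) (Aᶜ ∩ t') := disjoint_left.2 fun z hz hz' => by
    have : z ∈ Aᶜ ∩ (t ∩ t') := ⟨hz.1, hz.2, hz'.2⟩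
    rw [hempty] at this
    exact this
  have hunion : Aᶜ ∩ t ∪ Aᶜ ∩ t' = Aᶜ := by
    rw [← inter_union_distrib_left, inter_eq_left.2 hsub]
  by_cases hyi : y = OnePoint.infty
  · have hxi : x ≠ OnePoint.infty := by
      rintro rfl
      exact disjoint_left.1 hdisj hx (hyi ▸ hy)
    obtain ⟨q, rfl⟩ := OnePoint.ne_infty_iff_exists.1 hxi
    exact ⟨_, _, y, q, hAc.inter ht', hAc.inter ht, hdisj.symm, by rw [union_comm, hunion], hy, hx⟩
  · obtain ⟨q, rfl⟩ := OnePoint.ne_infty_iff_exists.1 hyi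
    exact ⟨_, _, x, q, hAc.inter ht, hAc.inter ht', hdisj, hunion, hx, hy⟩

lemma continuousOn_toC_mob {q : ℂ} {B : Set Sphere} (hq : (q : Sphere) ∉ B) :
    ContinuousOn (fun z => toC (mob q z)) B := fun _ hz =>
  (ContinuousAt.comp (g := toC) (continuousAt_toC fun h => hq (mob_eq_infty.1 h ▸ hz))
    (mob q).continuous.continuousAt).continuousWithinAt

/-- An annulus contains a connected compact set that, in a chart sending a point of the complement
to `∞`, contains the boundary of a bounded open set `W`, which in turn contains a point of the
complement. -/
lemma IsAnnulus.exists_separating {A : Set Sphere} (hA : IsAnnulus A) :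
    ∃ (K : Set Sphere) (q p : ℂ) (W : Set ℂ), IsCompact K ∧ IsConnected K ∧ K ⊆ A ∧
      (q : Sphere) ∉ A ∧ (mob q).symm (p : Sphere) ∉ A ∧ Bornology.IsBounded W ∧ p ∈ W ∧
      frontier W ⊆ (fun z => toC (mob q z)) '' K := by
  obtain ⟨E, E', p, q, hE, hE', hdisj, hunion, hp, hq⟩ := hA.exists_isClosed
  have hcont : Continuous fun w : ℂ => (mob q).symm w :=
    (mob q).symm.continuous.comp OnePoint.continuous_coe
  have hqE : (q : Sphere) ∉ E := fun h => disjoint_left.1 hdisj h hq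
  have hqA : (q : Sphere) ∉ A := by
    have : (q : Sphere) ∈ Aᶜ := hunion ▸ Or.inr hq
    exact this
  have hpA : p ∉ A := by
    have : p ∈ Aᶜ := hunion ▸ Or.inl hp
    exact this
  have hne : ∀ {B : Set Sphere}, (q : Sphere) ∉ B → ∀ z ∈ B, (mob q).symm (toC (mob q z)) = z :=
    fun hqB z hz => mob_symm_toC fun h => hqB (mob_eq_infty.1 h ▸ hz)
  set E₁ : Set ℂ := (fun z => toC (mob q z)) '' E with hE₁
  have hE₁c : IsCompact E₁ := hE.isCompact.image_of_continuousOn (continuousOn_toC_mob hqE)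
  set X : Set ℂ := {w | (mob q).symm w ∈ A} with hX
  have hXo : IsOpen X := hA.1.preimage hcont
  have hXimg : X = (fun z => toC (mob q z)) '' A := by
    ext w
    constructor
    · intro hw; exact ⟨_, hw, by simp⟩
    · rintro ⟨z, hz, rfl⟩
      change (mob q).symm _ ∈ A
      rwa [hne hqA z hz]
  have hXc : IsPreconnected X := by
    rw [hXimg]; exact hA.2.1.isPreconnected.image _ (continuousOn_toC_mob hqA)
  have hO : IsOpen {w : ℂ | (mob q).symm w ∉ E'} := hE'.isOpen_compl.preimage hcont
  obtain ⟨δ, hδ, hthick⟩ := hE₁c.exists_cthickening_subset_open hO (by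
    rintro _ ⟨z, hz, rfl⟩
    change (mob q).symm _ ∉ E'
    rw [hne hqE z hz]
    exact fun h => disjoint_left.1 hdisj hz h)
  set W := Metric.thickening δ E₁ with hW
  have hWo : IsOpen W := Metric.isOpen_thickening
  have hWb : Bornology.IsBounded W := hE₁c.isBounded.thickening
  have hpW : toC (mob q p) ∈ W := Metric.self_subset_thickening hδ _ (mem_image_of_mem _ hp)
  have hWX : frontier W ⊆ X := by
    intro w hw
    rw [hWo.frontier_eq] at hw
    by_contra hwX
    have : (mob q).symm (w : Sphere) ∈ E ∪ E' := by rw [hunion]; exact hwX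
    rcases this with h | h
    · exact hw.2 (Metric.self_subset_thickening hδ _ ⟨_, h, by simp⟩)
    · exact hthick (Metric.closure_thickening_subset_cthickening _ _ hw.1) h
  have hfrc : IsCompact (frontier W) :=
    Metric.isCompact_of_isClosed_isBounded isClosed_frontier
      (hWb.closure.subset frontier_subset_closure)
  obtain ⟨C, hC, hCc, hC₀, hCX⟩ := exists_isCompact_isPreconnected hXo hXc hfrc hWX
  obtain ⟨w₀, hw₀⟩ : (frontier W).Nonempty := by
    rw [nonempty_frontier_iff]
    refine ⟨⟨_, hpW⟩, fun h => ?_⟩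
    rw [h] at hWb
    exact NormedSpace.unbounded_univ ℂ ℂ hWb
  refine ⟨(fun w : ℂ => (mob q).symm w) '' C, q, toC (mob q p), W, hC.image hcont,
    ⟨⟨_, mem_image_of_mem _ (hC₀ hw₀)⟩, hCc.image _ hcont.continuousOn⟩, ?_, hqA, ?_, hWb, hpW, ?_⟩
  · rintro _ ⟨w, hw, rfl⟩
    exact hCX hw
  · rwa [hne hqE p hp]
  · intro w hw
    exact ⟨_, mem_image_of_mem _ (hC₀ hw), by simp⟩

/-! ### Wandering annuli -/

/-- A Fatou component that is an annulus, along whose orbit the rational map is a covering, is not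
wandering: two of its images intersect. -/
theorem exists_not_disjoint_of_isAnnulus {R : RatFunc ℂ} (hR : 1 ≤ ratDegree R)
    {A : ℕ → Set Sphere} (hcomp : IsFatouComponent (ratMap R) (A 0)) (hann : IsAnnulus (A 0))
    (hA : ∀ n, A (n + 1) = ratMap R '' A n) {d : ℕ → ℕ}
    (hcov : ∀ n, IsCoveringOfDegree (ratMap R) (A n) (A (n + 1)) (d n)) :
    ∃ m n, m ≠ n ∧ ¬ Disjoint (A m) (A n) := by
  by_contra! hdisj
  set f := ratMap R with hf
  obtain ⟨K, q, p, W, hK, hKc, hKA, hqA, hpA, hWb, hpW, hWK⟩ := hann.exists_separating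
  -- a chart that sends a point of `A 0` to `∞`
  obtain ⟨a, ha⟩ := OnePoint.denseRange_coe.exists_mem_open hann.1 hann.2.1.nonempty
  obtain ⟨r, hr, hball⟩ := Metric.isOpen_iff.1 (hann.1.preimage OnePoint.continuous_coe) a ha
  rw [← image_subset_iff] at hball
  obtain ⟨δ, hδ0, hδ⟩ := exists_pos_forall_ne_infty R a r⁻¹
  have hpre := hann.2.1.isPreconnected
  obtain ⟨N₀, hN₀⟩ := eventually_atTop.1 (eventually_oscillation_lt hR hA hann.1 hpre hr hball
    hdisj hK hKA (half_pos hδ0))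
  set N := N₀ + 1 with hN
  have hbd : ∀ z ∈ A N, mob a z ≠ OnePoint.infty ∧ ‖toC (mob a z)‖ ≤ r⁻¹ := fun z hz =>
    bounded_orbit hr hball hdisj (by omega) hz
  have haN : (a : Sphere) ∉ A N := fun h => (hbd _ h).1 (mob_self a)
  have hKN : MapsTo f^[N] K (A N) := fun x hx => by simpa using iterate_mem hA (hKA hx) N
  -- the image of `K` in the chart, and the components of its complement
  set k : Sphere → ℂ := fun x => toC (mob a (f^[N] x)) with hk
  have hkc : ContinuousOn k K := (continuousOn_toC_mob haN).comp
    ((continuous_ratMap R).iterate N).continuousOn hKN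
  have hkK : IsCompact (k '' K) := hK.image_of_continuousOn hkc
  have hcont : Continuous fun w : ℂ => (mob a).symm w :=
    (mob a).symm.continuous.comp OnePoint.continuous_coe
  set O : Set ℂ := {w | (mob a).symm w ∈ A N} with hO
  have hOo : IsOpen O := (isOpen_orbit hR hA hann.1 N).preimage hcont
  have hkO : k '' K ⊆ O := by
    rintro _ ⟨x, hx, rfl⟩
    change (mob a).symm _ ∈ A N
    rw [mob_symm_toC (hbd _ (hKN hx)).1]
    exact hKN hx
  have hr' : 0 < r⁻¹ := inv_pos.2 hr
  have hkball : k '' K ⊆ Metric.closedBall 0 r⁻¹ := by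
    rintro _ ⟨x, hx, rfl⟩
    simpa using (hbd _ (hKN hx)).2
  have hfar : {z : ℂ | r⁻¹ < ‖z‖} ⊆ (k '' K)ᶜ := fun z hz h => by
    have := hkball h
    rw [mem_closedBall_zero_iff] at this
    exact absurd this (not_le.2 hz)
  have hp₁ : ((r⁻¹ + 2 : ℝ) : ℂ) ∈ {z : ℂ | r⁻¹ < ‖z‖} := by
    rw [mem_ofPred_eq, Complex.norm_real, Real.norm_of_nonneg (by positivity)]
    linarith
  have hkKo : IsOpen (k '' K)ᶜ := hkK.isClosed.isOpen_compl
  set V := connectedComponentIn (k '' K)ᶜ ((r⁻¹ + 2 : ℝ) : ℂ) with hV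
  have hfarV : {z : ℂ | r⁻¹ < ‖z‖} ⊆ V :=
    (isPreconnected_setOf_lt_norm hr').subset_connectedComponentIn hp₁ hfar
  have hOV : Oᶜ ⊆ V := by
    intro w hwO
    by_contra hwV
    have hwK : w ∈ (k '' K)ᶜ := fun h => hwO (hkO h)
    have hWb : Bornology.IsBounded (connectedComponentIn (k '' K)ᶜ w) := by
      refine (Metric.isBounded_closedBall (x := (0 : ℂ)) (r := r⁻¹)).subset fun v hv => ?_
      by_contra hvb
      have hvV : v ∈ V := hfarV (by simpa using hvb)
      refine hwV ?_
      rw [hV, connectedComponentIn_eq hvV, ← connectedComponentIn_eq hv]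
      exact mem_connectedComponentIn hwK
    refine hwO (subset_of_frontier_subset hR hcomp hA hann.1 hpre hr hball hdisj hδ0 hδ hK hKA
      (N := N) (by omega) (fun n hn => hN₀ n (by omega)) hkKo.connectedComponentIn
      isPreconnected_connectedComponentIn hWb ?_ w (mem_connectedComponentIn hwK))
    exact (frontier_connectedComponentIn_subset hkKo w).trans (compl_compl _).subset
  -- hence the image of `K` has a grid neighbourhood in `A N` that lifts back to `A 0`
  obtain ⟨c, η, Q, n, hη, hQ, hKG, hGO⟩ := exists_gridRegion hr'.le hkK hkball hOo
    hkKo.connectedComponentIn isPreconnected_connectedComponentIn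
    (connectedComponentIn_subset _ _) (hfarV hp₁) hOV
  have hkG : MapsTo k K (gridRegion c η Q n) := fun x hx => hKG (mem_image_of_mem _ hx)
  obtain ⟨s, hs, hsA, hsk⟩ := exists_lift_iterate (continuous_ratMap R) hA hcov hη hQ hKc hKA hkc
    hkG N (fun w : ℂ => (mob a).symm w) hcont.continuousOn hGO
    (fun x hx => mob_symm_toC (hbd _ (hKN hx)).1)
  -- this yields a logarithm of `z - p` on `K`, in the chart that sends `q` to `∞`
  have hgp : ∀ z ∈ A 0, toC (mob q z) - p ≠ 0 := by
    intro z hz h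
    rw [sub_eq_zero] at h
    refine hpA ?_
    rw [← h, mob_symm_toC fun h => hqA (mob_eq_infty.1 h ▸ hz)]
    exact hz
  obtain ⟨l, hl, hlg⟩ := exists_log_gridRegion hη hQ (g := fun w => toC (mob q (s w)) - p)
    (((continuousOn_toC_mob hqA).comp hs hsA).sub continuousOn_const)
    (fun w hw => hgp _ (hsA hw))
  have hqK : (q : Sphere) ∉ K := fun h => hqA (hKA h)
  have hcq : Continuous fun w : ℂ => (mob q).symm w :=
    (mob q).symm.continuous.comp OnePoint.continuous_coe
  have hback : ∀ x ∈ K, (mob q).symm (toC (mob q x)) = x := fun x hx =>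
    mob_symm_toC fun h => hqK (mob_eq_infty.1 h ▸ hx)
  have hmaps : MapsTo (fun w : ℂ => (mob q).symm w) ((fun z => toC (mob q z)) '' K) K := by
    rintro _ ⟨x, hx, rfl⟩
    dsimp only
    rwa [hback x hx]
  refine false_of_exp_eq_sub (L := fun w => l (k ((mob q).symm w))) hWb hpW
    (hK.image_of_continuousOn (continuousOn_toC_mob hqK)) hWK
    (hl.comp (hkc.comp hcq.continuousOn hmaps) (hkG.comp hmaps)) ?_
  rintro _ ⟨x, hx, rfl⟩
  dsimp only
  rw [hback x hx, hlg _ (hkG hx), hsk x hx]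

end RationalDynamics

theorem proposition2p4p2
    (R : RatFunc ℂ) (hR : 2 ≤ RationalDynamics.ratDegree R)
    (A : ℕ → Set RationalDynamics.Sphere)
    (hA₀ : RationalDynamics.IsFatouComponent (RationalDynamics.ratMap R) (A 0))
    (hann : RationalDynamics.IsAnnulus (A 0))
    (hA : ∀ n : ℕ, A (n + 1) = RationalDynamics.ratMap R '' A n)
    (d : ℕ → ℕ)
    (hcov : ∀ n : ℕ,
      RationalDynamics.IsCoveringOfDegree (RationalDynamics.ratMap R) (A n) (A (n + 1)) (d n))
    (hdisj : ∀ m n : ℕ, m ≠ n → Disjoint (A m) (A n)) :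
    ∃ N : ℕ, ∀ n : ℕ, N ≤ n → d n = 1 := by
  obtain ⟨m, n, hmn, hnd⟩ :=
    RationalDynamics.exists_not_disjoint_of_isAnnulus (one_le_two.trans hR) hA₀ hann hA hcov
  exact absurd (hdisj m n hmn) hnd
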